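/- Let $G$ be a biconnected plane series-parallel graph with vertex degree at most four, with a reference edge $e=(s,t)$ on its external face, and let $T$ be its decomposition tree with respect to $e$, so that the root of $T$ is the parallel composition of $e$ with the rest of $G$, and the children of each P-node are ordered from left to right as in the embedding. An orthogonal representation $H$ of $G$ assigns an angle in $\{90^\circ,180^\circ,270^\circ,360^\circ\}$ to each corner of $G$ and a sequence of left and right bends to each edge, such that the angles at each vertex sum to $360^\circ$ and each face $f$ satisfies $N_{90}(f)-N_{270}(f)-2N_{360}(f)=4$ (with $-4$ instead of $4$ for the external face), where $N_a(f)$ is the number of angles of $a$ degrees in $f$, at vertices and at bends. For a node $\nu$ of $T$ with pertinent graph $G_\nu$ and poles $u,v$ ($u$ on the side of $s$), an orthogonal representation $H_\nu$ of $G_\nu$ is the restriction to $G_\nu$ of an orthogonal representation $H$ of $G$; its bends are the bends of $H$ on edges of $G_\nu$ (bends of $H$ on other edges do not count). The spirality $\sigma(H_\nu)$ is defined as follows. A pole $w$ whose degree in $G_\nu$ is one is its own alias vertex; otherwise $w$ has one alias vertex on each edge segment incident to $w$ outside $G_\nu$. A spine is a path that starts at an alias vertex $u'$ of $u$, follows any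 simple path of $G_\nu$ from $u$ to $v$, and ends at an alias vertex $v'$ of $v$; $n(u',v')$ is the number of right turns minus the number of left turns along it. Then $\sigma(H_\nu)$ is the mean of $n(u',v')$ for $u',v'$ the leftmost alias vertices of $u$ and $v$, and of $n(u',v')$ for $u',v'$ the rightmost ones. (It does not depend on the simple path.) The graph $G_\nu$ is rectilinear planar if it has an orthogonal representation without bends; the representability interval $[m,M]$ of $\nu$ then consists of the spiralities of these bend-free representations. Let $\nu$ be a P-node of $T$ with three children $\mu_l,\mu_c,\mu_r$ in this left-to-right order. Suppose that $G_{\mu_l}$, $G_{\mu_c}$, $G_{\mu_r}$ are rectilinear planar, with representability intervals $[m_l,M_l]$, $[m_c,M_c]$, $[m_r,M_r]$, and that $G_\nu$ is not rectilinear planar. Put $$[\overline m_l,\overline M_l]=[m_l-2,M_l-2],\qquad [\overline m_c,\overline M_c]=[m_c,M_c],\qquad [\overline m_r,\overline M_r]=[m_r+2,M_r+2],$$ and let $x,z\in\{l,c,r\}$ be such that $\overline m_z=\max\{\overline m_l,\overline m_c,\overline m_r\}$ and $\overline M_x=\min\{\overline M_l,\overline M_c,\overline M_r\}$. Then $x\neq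 z$. Moreover, if $y$ is the element of $\{l,c,r\}$ other than $x$ and $z$, then: (i) the minimum number of bends of an orthogonal representation of $G_\nu$ (the budget of $\nu$) is $b_\nu=\overline m_z-\overline M_x$; (ii) the set of the spiralities of the orthogonal representations of $G_\nu$ with exactly $b_\nu$ bends is the set of all integers in the interval $[\max\{\overline M_x,\overline m_y\},\min\{\overline m_z,\overline M_y\}]$. -/

import Mathlib

namespace OrthoSP

/-! ### Plane graphs -/

/-- A plane graph without isolated vertices, given combinatorially by its darts (edges with a
direction). `rev` reverses a dart; `cw d` is the dart that follows `d` in clockwise order around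
the origin of `d`. The vertices are the orbits of `cw`. The dart `ref` is the reference edge,
directed from the source `s` to the sink `t`; the external face lies to the right of `ref`. -/
structure PlaneGraph (D : Type*) where
  rev : Equiv.Perm D
  rev_rev : ∀ d, rev (rev d) = d
  rev_ne : ∀ d, rev d ≠ d
  cw : Equiv.Perm D
  ref : D

namespace PlaneGraph

variable {D : Type*}

/-- The dart that follows `d` on the boundary of the face to the right of `d`. The faces are the
orbits of this permutation (internal faces are traversed clockwise). At the head of `d` the
boundary passes through the corner from `faceNext d` clockwise to `rev d`. -/
def faceNext (G : PlaneGraph D) : Equiv.Perm D := G.rev.trans G.cw.symm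

/-- Every vertex has degree at most four. -/
def IsFourGraph (G : PlaneGraph D) : Prop :=
  ∀ d, {d' | G.cw.SameCycle d d'}.ncard ≤ 4

end PlaneGraph

/-! ### Orthogonal representations -/

/-- A bend of an edge, in a given direction of travel: a left turn or a right turn. -/
inductive Turn
  | left
  | right

namespace Turn

/-- The same bend seen when travelling in the opposite direction. -/
def flip : Turn → Turn
  | left => right
  | right => left

/-- A right turn counts `1`, a left turn counts `-1`. -/
def val : Turn → ℤ
  | left => -1
  | right => 1

end Turn

/-- An embedding-preserving orthogonal representation of the plane graph `G`.

* `ang d` is the angle, in multiples of `90` degrees, between `d` and the next dart `cw d` in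
  clockwise order around the origin of `d`;
* `bends d` is the sequence of bends along `d`, travelling from the origin of `d` to its head.

`H1`: the angles around each vertex sum up to `360` degrees.
`H2`: in each face, (number of `90` degree angles) - (number of `270` degree angles)
- 2 (number of `360` degree angles) is `4`, or `-4` for the external face. A vertex angle `a`
contributes `2 - a`; a bend of a boundary dart that has the face on its right makes in that face
an angle of `90` degrees if it is a right turn, and of `270` degrees if it is a left turn. -/
structure OrthRep {D : Type*} [Fintype D] [DecidableEq D] (G : PlaneGraph D) where
  ang : D → ℕ
  bends : D → List Turn
  ang_mem : ∀ d, 1 ≤ ang d ∧ ang d ≤ 4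
  bends_rev : ∀ d, bends (G.rev d) = ((bends d).map Turn.flip).reverse
  H1 : ∀ d, ∑ x ∈ Finset.univ.filter (fun x => G.cw.SameCycle d x), ang x = 4
  H2 : ∀ d, ∑ x ∈ Finset.univ.filter (fun x => G.faceNext.SameCycle d x),
      ((2 - (ang x : ℤ)) + ((bends x).map Turn.val).sum)
        = if G.faceNext.SameCycle d G.ref then -4 else 4

/-! ### Series-parallel decomposition trees -/

/-- Decomposition trees of plane series-parallel graphs. A leaf is an edge, given by its dart from
the source side to the sink side. A series composition of more than two graphs is an iterated
`series`; a Q*-node is an iterated `series` of leaves. The children of P-nodes (with two or three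
children) are listed from left to right, where the source is at the bottom, the sink at the top. -/
inductive SPTree (D : Type*)
  | edge (d : D)
  | series (a b : SPTree D)
  | par2 (a b : SPTree D)
  | par3 (a b c : SPTree D)

namespace SPTree

variable {D : Type*}

/-- The edges of the pertinent graph, as darts directed from source to sink. -/
def edges : SPTree D → List D
  | edge d => [d]
  | series a b => a.edges ++ b.edges
  | par2 a b => a.edges ++ b.edges
  | par3 a b c => a.edges ++ b.edges ++ c.edges

/-- The darts of the pertinent graph that leave its source pole, from left to right. -/
def sourceDarts : SPTree D → List D
  | edge d => [d]
  | series a _ => a.sourceDarts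
  | par2 a b => a.sourceDarts ++ b.sourceDarts
  | par3 a b c => a.sourceDarts ++ b.sourceDarts ++ c.sourceDarts

/-- The darts of the pertinent graph that leave its sink pole, from left to right. -/
def sinkDarts (G : PlaneGraph D) : SPTree D → List D
  | edge d => [G.rev d]
  | series _ b => b.sinkDarts G
  | par2 a b => a.sinkDarts G ++ b.sinkDarts G
  | par3 a b c => a.sinkDarts G ++ b.sinkDarts G ++ c.sinkDarts G

/-- The vertices of the pertinent graph other than the poles, each given by the list of the darts
that leave it, in clockwise order. The sink of `a` and the source of `b` become one vertex in
`series a b`. -/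
def innerVertices (G : PlaneGraph D) : SPTree D → List (List D)
  | edge _ => []
  | series a b => a.innerVertices G ++ b.innerVertices G
      ++ [b.sourceDarts ++ (a.sinkDarts G).reverse]
  | par2 a b => a.innerVertices G ++ b.innerVertices G
  | par3 a b c => a.innerVertices G ++ b.innerVertices G ++ c.innerVertices G

/-- `IsPath T P`: the list of darts `P` is a simple path from the source to the sink of the
pertinent graph of `T`. Such a path stays inside one child of a P-node, and it runs through all
the children of an S-node in order. -/
inductive IsPath : SPTree D → List D → Prop
  | edge (d : D) : IsPath (.edge d) [d]
  | series {a b : SPTree D} {P Q : List D} :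
      IsPath a P → IsPath b Q → IsPath (.series a b) (P ++ Q)
  | par2_left {a b : SPTree D} {P : List D} : IsPath a P → IsPath (.par2 a b) P
  | par2_right {a b : SPTree D} {P : List D} : IsPath b P → IsPath (.par2 a b) P
  | par3_left {a b c : SPTree D} {P : List D} : IsPath a P → IsPath (.par3 a b c) P
  | par3_center {a b c : SPTree D} {P : List D} : IsPath b P → IsPath (.par3 a b c) P
  | par3_right {a b c : SPTree D} {P : List D} : IsPath c P → IsPath (.par3 a b c) P

/-- `IsNode ν T`: `ν` is (the subtree rooted at) a node of `T`. -/
inductive IsNode : SPTree D → SPTree D → Prop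
  | refl (T : SPTree D) : IsNode T T
  | series_left {ν a b : SPTree D} : IsNode ν a → IsNode ν (.series a b)
  | series_right {ν a b : SPTree D} : IsNode ν b → IsNode ν (.series a b)
  | par2_left {ν a b : SPTree D} : IsNode ν a → IsNode ν (.par2 a b)
  | par2_right {ν a b : SPTree D} : IsNode ν b → IsNode ν (.par2 a b)
  | par3_left {ν a b c : SPTree D} : IsNode ν a → IsNode ν (.par3 a b c)
  | par3_center {ν a b c : SPTree D} : IsNode ν b → IsNode ν (.par3 a b c)
  | par3_right {ν a b c : SPTree D} : IsNode ν c → IsNode ν (.par3 a b c)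

end SPTree

/-- `G.HasSPTree T`: the plane graph `G` is the parallel composition of the plane series-parallel
graph with decomposition tree `T` (on the left) and of the reference edge (on the right), with the
external face to the right of the reference edge. Hence the decomposition tree of `G` with respect
to the reference edge has a root with two children: the root of `T`, and the reference edge.

The first condition says that the edges of `G` are, without repetition, those of `T` and the
reference edge. The second one says that the clockwise order of the darts around each vertex is
the one given by `T`. The last two lists belong to the source and to the sink of `G`. -/
structure PlaneGraph.HasSPTree {D : Type*} (G : PlaneGraph D) (T : SPTree D) : Prop where
  nodup : ((G.ref :: T.edges) ++ (G.ref :: T.edges).map G.rev).Nodup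
  complete : ∀ d, d ∈ (G.ref :: T.edges) ++ (G.ref :: T.edges).map G.rev
  rotation : ∀ L ∈ T.innerVertices G
      ++ [T.sourceDarts ++ [G.ref], G.rev G.ref :: (T.sinkDarts G).reverse],
    L.map G.cw = L.rotate 1

/-! ### Bends and spirality of a component -/

namespace OrthRep

variable {D : Type*} [Fintype D] [DecidableEq D] {G : PlaneGraph D}

/-- The number of bends of the restriction of `H` to the pertinent graph of `ν`. -/
def numBends (H : OrthRep G) (ν : SPTree D) : ℕ :=
  (ν.edges.map fun d => (H.bends d).length).sum

/-- The angle (in multiples of `90` degrees) from `d` clockwise to the dart `x` with the same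
origin. -/
noncomputable def cwAngle (H : OrthRep G) (d x : D) : ℕ :=
  ∑ i ∈ Finset.range (sInf {k : ℕ | (G.cw ^ k) d = x}), H.ang ((G.cw ^ i) d)

/-- The turn made at the head of `d` when the walk continues along `d'`: `1` for a right turn,
`-1` for a left turn, `0` for going straight on. The angle on the right-hand side of the walk is
the one from `d'` clockwise to `rev d`. -/
noncomputable def vertexTurn (H : OrthRep G) (d d' : D) : ℤ :=
  2 - (H.cwAngle d' (G.rev d) : ℤ)

/-- Right turns minus left turns along a walk, at bends and at the vertices in its interior. -/
noncomputable def pathTurn (H : OrthRep G) : List D → ℤ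
  | [] => 0
  | [d] => ((H.bends d).map Turn.val).sum
  | d :: d' :: P => ((H.bends d).map Turn.val).sum + H.vertexTurn d d' + H.pathTurn (d' :: P)

/-- The turn at the source pole of `ν` of the spine that uses the path `P` and the alias vertex on
the external dart `x`. If the source has degree one in the pertinent graph, then the alias vertex
is the pole itself, and there is no turn. -/
noncomputable def sourceTurn (H : OrthRep G) (ν : SPTree D) (P : List D) (x : Option D) : ℤ :=
  if ν.sourceDarts.length = 1 then 0
  else match x, P.head? with
    | some x, some d => H.vertexTurn (G.rev x) d
    | _, _ => 0

/-- The turn at the sink pole of `ν` of the spine that uses the path `P` and the alias vertex on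
the external dart `y`. -/
noncomputable def sinkTurn (H : OrthRep G) (ν : SPTree D) (P : List D) (y : Option D) : ℤ :=
  if (ν.sinkDarts G).length = 1 then 0
  else match P.getLast?, y with
    | some d, some y => H.vertexTurn d y
    | _, _ => 0

/-- `n(S)` for the spine `S` of `ν` that uses the path `P` and, at each pole, the alias vertex on
the leftmost dart outside the pertinent graph. -/
noncomputable def leftSpineTurn (H : OrthRep G) (ν : SPTree D) (P : List D) : ℤ :=
  H.sourceTurn ν P (ν.sourceDarts.head?.map G.cw.symm) + H.pathTurn P
    + H.sinkTurn ν P ((ν.sinkDarts G).head?.map G.cw)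

/-- `n(S)` for the spine `S` of `ν` that uses the path `P` and, at each pole, the alias vertex on
the rightmost dart outside the pertinent graph. -/
noncomputable def rightSpineTurn (H : OrthRep G) (ν : SPTree D) (P : List D) : ℤ :=
  H.sourceTurn ν P (ν.sourceDarts.getLast?.map G.cw) + H.pathTurn P
    + H.sinkTurn ν P ((ν.sinkDarts G).getLast?.map G.cw.symm)

/-- The restriction of `H` to the pertinent graph of `ν` has spirality `σ`, whichever path from
the source to the sink is used. In a graph of maximum degree four a pole has one or two alias
vertices. If there is only one at a pole, then it is both the leftmost and the rightmost one; if
both poles have two, then the left ones are paired, and so are the right ones. So the mean below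
is the definition of the spirality in each of the four cases. -/
def HasSpirality (H : OrthRep G) (ν : SPTree D) (σ : ℚ) : Prop :=
  ∀ P, ν.IsPath P → σ = ((H.leftSpineTurn ν P : ℚ) + (H.rightSpineTurn ν P : ℚ)) / 2

end OrthRep

namespace PlaneGraph

variable {D : Type*} [Fintype D] [DecidableEq D]

/-- The spiralities of the orthogonal representations, with exactly `b` bends, of the pertinent
graph of `ν` (as a component of `G`, that is, of the restrictions to the pertinent graph of the
orthogonal representations of `G`; bends outside the pertinent graph are not counted). -/
def spiralities (G : PlaneGraph D) (ν : SPTree D) (b : ℕ) : Set ℚ :=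
  {σ | ∃ H : OrthRep G, H.numBends ν = b ∧ H.HasSpirality ν σ}

/-- The pertinent graph of `ν` is rectilinear planar: it has an orthogonal representation, as a
component of `G`, without bends. -/
def RectilinearPlanar (G : PlaneGraph D) (ν : SPTree D) : Prop :=
  ∃ H : OrthRep G, H.numBends ν = 0

/-- `b` is the least number of bends of an orthogonal representation of the pertinent graph of
`ν`, as a component of `G`. -/
def IsBudget (G : PlaneGraph D) (ν : SPTree D) (b : ℕ) : Prop :=
  IsLeast {n | ∃ H : OrthRep G, H.numBends ν = n} b

/-- `m` and `M` are the endpoints of the representability interval of `ν`: the least and the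
greatest spirality of a representation of the pertinent graph of `ν` without bends. -/
def HasRepresentabilityEndpoints (G : PlaneGraph D) (ν : SPTree D) (m M : ℤ) : Prop :=
  IsLeast (G.spiralities ν 0) (m : ℚ) ∧ IsGreatest (G.spiralities ν 0) (M : ℚ)

end PlaneGraph

end OrthoSP

/-! The proof reduces the problem to minimising a sum of three distances on the integers.

Each pole has a dart outside the P-node and degree at most four. Hence each child has one dart at
each pole, one dart lies outside, and all pole angles are 90 degrees. The two faces between
consecutive children then force their spiralities to be `s + 2`, `s`, `s - 2`, where `s` is the
spirality of the node (`Triple.turn_left`, `Triple.turn_right`, `Triple.hasSpirality`). Conversely,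
representations of the children with such spiralities can be glued (`Triple.combine`, by
`Pendant.exchange`). So the least number of bends at spirality `s` is the sum of the least costs of
the children at `s + 2`, `s`, `s - 2`.

The cost of a child at spirality `s` is the distance from `s` to its representability interval. For
the upper bound, `k` bends are put on the child's edge at a pole: rotating the pole (`star`) changes
the turn by `k` and keeps all face conditions. For the lower bound, the cost is discretely convex in
the spirality (`Branch.convex`). As in Tamassia's flow model, two representations of the child
differ by a circulation, once an extra arc absorbs the difference of the turns. A unit circulation
through that arc, conformal to the difference, moves the two turns one step towards each other
without increasing the total cost. A convex integer cost that is zero exactly on the interval grows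
by at least one per step outside it (`Branch.le_add_bendCost`, `Branch.sub_bendCost_le`); convexity
also fills the interval (`Branch.exists_of_mem_interval`).

After shifting the intervals by -2, 0, 2, the total cost is the sum of the distances from `s` to
three intervals. No bend-free representation exists, so `Mbar x < mbar z`. The intervals `x` and `z`
together cost at least `mbar z - Mbar x`, with equality exactly between these two endpoints, and `y`
costs nothing exactly on its own interval.

Throughout, a representation is replaced by its angles and net bends (`IsRep`): bends of opposite
direction on one edge only add to the cost. -/

namespace OrthoSP

/-! ### Cyclic lists -/

section Cyclic

variable {D : Type*}

/-- `L` lists an orbit of the permutation `π`, in cyclic order and without repetition. -/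
structure IsCyc (π : Equiv.Perm D) (L : List D) : Prop where
  nodup : L.Nodup
  map_eq : L.map π = L.rotate 1

theorem IsCyc.rotate {π : Equiv.Perm D} {L : List D} (h : IsCyc π L) (n : ℕ) :
    IsCyc π (L.rotate n) :=
  ⟨List.nodup_rotate.2 h.nodup, by
    rw [List.map_rotate, h.map_eq, List.rotate_rotate, List.rotate_rotate, add_comm]⟩

theorem IsCyc.append_comm {π : Equiv.Perm D} {A B : List D} (h : IsCyc π (A ++ B)) :
    IsCyc π (B ++ A) := by
  have := h.rotate A.length
  rwa [List.rotate_append_length_eq] at this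

theorem IsCyc.apply_getElem {π : Equiv.Perm D} {L : List D} (h : IsCyc π L) {i : ℕ}
    (hi : i + 1 < L.length) : π (L[i]'(by omega)) = L[i + 1] := by
  have h1 : (L.map π)[i]'(by simpa using by omega) = (L.rotate 1)[i]'(by simpa using by omega) := by
    simp only [h.map_eq]
  rw [List.getElem_map, List.getElem_rotate] at h1
  rw [h1]
  congr 1
  exact Nat.mod_eq_of_lt hi

theorem IsCyc.apply_of_adjacent {π : Equiv.Perm D} {A B : List D} {x y : D}
    (h : IsCyc π (A ++ x :: y :: B)) : π x = y := by
  have := h.apply_getElem (i := A.length) (by simp)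
  simpa using this

theorem IsCyc.pow_head {π : Equiv.Perm D} {L : List D} (h : IsCyc π L) :
    ∀ i (hi : i < L.length), (π ^ i) (L[0]'(by omega)) = L[i]
  | 0, _ => by simp
  | i + 1, hi => by
    rw [pow_succ', Equiv.Perm.mul_apply, h.pow_head i (by omega), h.apply_getElem hi]

theorem IsCyc.apply_mem {π : Equiv.Perm D} {L : List D} (h : IsCyc π L) {x : D} (hx : x ∈ L) :
    π x ∈ L := by
  have : π x ∈ L.map π := List.mem_map_of_mem hx
  rw [h.map_eq] at this
  exact List.mem_rotate.1 this

theorem IsCyc.symm_apply_mem {π : Equiv.Perm D} {L : List D} (h : IsCyc π L) {x : D}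
    (hx : x ∈ L) : π.symm x ∈ L := by
  have : x ∈ L.map π := by rw [h.map_eq]; exact List.mem_rotate.2 hx
  obtain ⟨y, hy, rfl⟩ := List.mem_map.1 this
  simpa using hy

theorem IsCyc.sameCycle_iff [Finite D] {π : Equiv.Perm D} {L : List D} (h : IsCyc π L) {d : D}
    (hd : d ∈ L) (x : D) : π.SameCycle d x ↔ x ∈ L := by
  constructor
  · intro hx
    obtain ⟨i, -, rfl⟩ := hx.exists_pow_eq'
    clear hx
    induction i with
    | zero => simpa using hd
    | succ i ih => rw [pow_succ', Equiv.Perm.mul_apply]; exact h.apply_mem ih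
  · have key : ∀ y ∈ L, ∃ hL : 0 < L.length, π.SameCycle (L[0]) y := by
      intro y hy
      obtain ⟨i, hi, rfl⟩ := List.getElem_of_mem hy
      exact ⟨by omega, i, by simpa using h.pow_head i hi⟩
    intro hx
    obtain ⟨_, h1⟩ := key d hd
    obtain ⟨_, h2⟩ := key x hx
    exact h1.symm.trans h2

/-- Turns the orbit sums of the vertex and face conditions into sums over explicit lists. -/
theorem IsCyc.sum_orbit [Fintype D] [DecidableEq D] {π : Equiv.Perm D} {L : List D}
    (h : IsCyc π L) {d : D} (hd : d ∈ L) {M : Type*} [AddCommMonoid M] (f : D → M) :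
    ∑ x ∈ Finset.univ.filter (fun x => π.SameCycle d x), f x = (L.map f).sum := by
  have : Finset.univ.filter (fun x => π.SameCycle d x) = L.toFinset := by
    ext x; simp [h.sameCycle_iff hd x]
  rw [this, List.sum_toFinset _ h.nodup]

theorem isCyc_of_isChain {π : Equiv.Perm D} {x y : D} {L : List D} (hn : L.Nodup)
    (hc : L.IsChain (fun a b => π a = b)) (hx : L.head? = some x) (hy : L.getLast? = some y)
    (hyx : π y = x) : IsCyc π L := by
  refine ⟨hn, ?_⟩
  obtain ⟨M, rfl⟩ : ∃ M, L = x :: M := by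
    cases L with
    | nil => simp at hx
    | cons z M => exact ⟨M, by simpa using hx⟩
  rw [List.rotate_cons_succ, List.rotate_zero]
  clear hn hx
  have key : ∀ (M : List D) (x z : D), (x :: M).IsChain (fun a b => π a = b) →
      (x :: M).getLast? = some y → π y = z → (x :: M).map π = M ++ [z] := by
    intro M
    induction M with
    | nil => intro x z _ h hz; simp at h; simp [h, hz]
    | cons w M ih =>
      intro x z hc h hz
      rw [List.isChain_cons_cons] at hc
      rw [List.map_cons, ih w z hc.2 (by simpa using h) hz, hc.1]
      rfl
  exact key M x x hc hy hyx

end Cyclic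

/-- The list has no repetition, so `M.length` is the first exponent that leads from `x` to `y`; for
empty `M` both sides are zero. -/
theorem cwAngle_eq_sum {D : Type*} [Fintype D] [DecidableEq D] {G : PlaneGraph D} (H : OrthRep G)
    {A M B : List D} {x y : D} (h : IsCyc G.cw (A ++ (M ++ y :: B)))
    (hx : (M ++ [y]).head? = some x) : H.cwAngle x y = (M.map H.ang).sum := by
  have h' : IsCyc G.cw (M ++ y :: (B ++ A)) := by simpa using h.append_comm
  set L := M ++ y :: (B ++ A) with hL
  have hlen : M.length < L.length := by simp [hL]
  have hx0 : L[0]'(by omega) = x := by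
    cases M with
    | nil => simpa [hL] using hx
    | cons z M => simpa [hL] using hx
  have hpow : ∀ i (hi : i < L.length), (G.cw ^ i) x = L[i] := by
    intro i hi; rw [← hx0]; exact h'.pow_head i hi
  have hy : L[M.length] = y := by simp [hL]
  have hinf : sInf {k : ℕ | (G.cw ^ k) x = y} = M.length := by
    refine IsLeast.csInf_eq ⟨by rw [Set.mem_ofPred_eq, hpow _ hlen, hy], ?_⟩
    intro k hk
    by_contra hlt
    push Not at hlt
    have hk' : L[k] = L[M.length] := by
      rw [hy, ← hpow k (by omega)]; exact hk
    have := (h'.nodup.getElem_inj_iff).1 hk'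
    omega
  rw [OrthRep.cwAngle, hinf, Finset.sum_range]
  have : ∀ i : Fin M.length, H.ang ((G.cw ^ (i : ℕ)) x) = H.ang M[i] := by
    intro i
    rw [hpow i (by omega)]
    simp [hL]
  rw [Finset.sum_congr rfl (fun i _ => this i), ← List.sum_ofFn]
  congr 1
  conv_rhs => rw [← List.ofFn_getElem (xs := M)]
  rw [List.map_ofFn]
  rfl

/-! ### Orbit sums -/

/-- The sum of `g` over each orbit of `π` vanishes. -/
def OrbitNull {D : Type*} [Fintype D] [DecidableEq D] (π : Equiv.Perm D) (g : D → ℤ) : Prop :=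
  ∀ d, ∑ x ∈ Finset.univ.filter (fun x => π.SameCycle d x), g x = 0

section OrbitNull

variable {D : Type*} [Fintype D] [DecidableEq D] {π : Equiv.Perm D} {g g' : D → ℤ}

theorem OrbitNull.add (h : OrbitNull π g) (h' : OrbitNull π g') :
    OrbitNull π (fun x => g x + g' x) := fun d => by
  rw [Finset.sum_add_distrib, h d, h' d, add_zero]

theorem OrbitNull.mul_const (h : OrbitNull π g) (k : ℤ) :
    OrbitNull π (fun x => k * g x) := fun d => by
  rw [← Finset.mul_sum, h d, mul_zero]

theorem sameCycle_iff_of_invariant {D : Type*} [Finite D] {π : Equiv.Perm D} {p : D → Prop}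
    (hp : ∀ x, p x → p (π x)) {x y : D} (h : π.SameCycle x y) : p x ↔ p y := by
  have key : ∀ {x y}, π.SameCycle x y → p x → p y := by
    intro x y h hx
    obtain ⟨i, -, rfl⟩ := h.exists_pow_eq'
    clear h
    induction i with
    | zero => simpa using hx
    | succ i ih => rw [pow_succ', Equiv.Perm.mul_apply]; exact hp _ ih
  exact ⟨key h, key h.symm⟩

theorem OrbitNull.restrict (h : OrbitNull π g) {p : D → Prop} [DecidablePred p]
    (hp : ∀ x, p x → p (π x)) : OrbitNull π (fun x => if p x then g x else 0) := fun d => by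
  by_cases hd : p d
  · rw [← h d]
    refine Finset.sum_congr rfl fun x hx => if_pos ?_
    exact (sameCycle_iff_of_invariant hp (by simpa using hx)).1 hd
  · refine Finset.sum_eq_zero fun x hx => if_neg ?_
    exact fun h' => hd ((sameCycle_iff_of_invariant hp (by simpa using hx)).2 h')

/-- A function supported on a part of an orbit, with vanishing sum. -/
theorem orbitNull_of_list {L : List D} (hn : L.Nodup)
    (hL : ∀ x ∈ L, ∀ y ∈ L, π.SameCycle x y) (hs : (L.map g).sum = 0) :
    OrbitNull π (fun x => if x ∈ L then g x else 0) := fun d => by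
  by_cases hd : ∃ x ∈ L, π.SameCycle d x
  · obtain ⟨x, hx, hdx⟩ := hd
    refine Eq.trans ?_ hs
    rw [← List.sum_toFinset _ hn, ← Finset.sum_filter, Finset.filter_filter]
    refine Finset.sum_congr ?_ fun _ _ => rfl
    ext y
    simp only [Finset.mem_filter, Finset.mem_univ, true_and, List.mem_toFinset]
    exact ⟨fun h => h.2, fun h => ⟨hdx.trans (hL x hx y h), h⟩⟩
  · push Not at hd
    refine Finset.sum_eq_zero fun x hx => if_neg fun h => hd x h (by simpa using hx)

/-- The coboundary of a function has vanishing orbit sums. -/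
theorem orbitNull_sub_comp (f : D → ℤ) : OrbitNull π (fun x => f x - f (π x)) := fun d => by
  rw [Finset.sum_sub_distrib, sub_eq_zero]
  refine (Finset.sum_equiv π ?_ fun _ _ => rfl).symm
  intro i
  simp

/-- With its converse `orbitNull_of_sum_mul`, this rephrases vanishing orbit sums as orthogonality
to potentials on the orbits, the form in which circulations are stated. -/
theorem OrbitNull.sum_mul (h : OrbitNull π g) (φ : Quotient (Equiv.Perm.SameCycle.setoid π) → ℤ) :
    ∑ x, φ (Quotient.mk _ x) * g x = 0 := by
  classical
  rw [← Finset.sum_fiberwise (s := Finset.univ)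
    (g := fun x : D => (Quotient.mk (Equiv.Perm.SameCycle.setoid π) x))]
  refine Finset.sum_eq_zero fun q _ => ?_
  induction q using Quotient.inductionOn with
  | h d =>
    have : ∑ i ∈ Finset.univ.filter (fun i => (Quotient.mk (Equiv.Perm.SameCycle.setoid π) i)
        = Quotient.mk _ d), φ (Quotient.mk _ i) * g i
        = φ (Quotient.mk _ d) *
          ∑ x ∈ Finset.univ.filter (fun x => π.SameCycle d x), g x := by
      rw [Finset.mul_sum]
      refine Finset.sum_congr ?_ ?_
      · ext x
        simp only [Finset.mem_filter, Finset.mem_univ, true_and]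
        rw [Quotient.eq]
        exact Equiv.Perm.sameCycle_comm
      · intro x hx
        rw [Finset.mem_filter] at hx
        have : π.SameCycle d x := hx.2
        rw [Quotient.sound (s := Equiv.Perm.SameCycle.setoid π) this]
    rw [this, h d, mul_zero]

theorem orbitNull_of_sum_mul
    (h : ∀ φ : Quotient (Equiv.Perm.SameCycle.setoid π) → ℤ, ∑ x, φ (Quotient.mk _ x) * g x = 0) :
    OrbitNull π g := fun d => by
  classical
  rw [← h (fun q => if q = Quotient.mk _ d then 1 else 0), Finset.sum_filter]
  refine Finset.sum_congr rfl fun x _ => ?_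
  simp only [ite_mul, one_mul, zero_mul]
  refine if_congr ?_ rfl rfl
  rw [Quotient.eq]
  exact Equiv.Perm.sameCycle_comm

end OrbitNull

theorem IsCyc.apply_getLast {D : Type*} {π : Equiv.Perm D} {A B : List D} {y z : D}
    (h : IsCyc π (A ++ B)) (hy : A.getLast? = some y) (hz : B.head? = some z) : π y = z := by
  obtain ⟨A, rfl⟩ := List.getLast?_eq_some_iff.1 hy
  obtain ⟨B, rfl⟩ : ∃ B', B = z :: B' := by
    cases B with
    | nil => simp at hz
    | cons w B => exact ⟨B, by simpa using hz⟩
  exact IsCyc.apply_of_adjacent (A := A) (B := B) (by simpa using h)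

theorem PlaneGraph.faceNext_eq {D : Type*} (G : PlaneGraph D) {x y : D}
    (h : G.cw y = G.rev x) : G.faceNext x = y := by
  simp [PlaneGraph.faceNext, ← h]

/-! ### Boundaries of pertinent graphs -/

namespace SPTree

variable {D : Type*}

/-- The rightmost path from the source to the sink. -/
def rightBoundary : SPTree D → List D
  | edge d => [d]
  | series a b => a.rightBoundary ++ b.rightBoundary
  | par2 _ b => b.rightBoundary
  | par3 _ _ c => c.rightBoundary

/-- The leftmost path, walked from the sink to the source. -/
def leftBoundary (G : PlaneGraph D) : SPTree D → List D
  | edge d => [G.rev d]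
  | series a b => b.leftBoundary G ++ a.leftBoundary G
  | par2 a _ => a.leftBoundary G
  | par3 a _ _ => a.leftBoundary G

/-- All the darts of the pertinent graph. -/
def darts (G : PlaneGraph D) (ν : SPTree D) : List D := ν.edges ++ ν.edges.map G.rev

variable {G : PlaneGraph D}

theorem sourceDarts_sublist (ν : SPTree D) : ν.sourceDarts.Sublist ν.edges := by
  induction ν with
  | edge d => exact List.Sublist.refl _
  | series a b iha ihb => exact iha.trans (List.sublist_append_left _ _)
  | par2 a b iha ihb => exact iha.append ihb
  | par3 a b c iha ihb ihc => exact (iha.append ihb).append ihc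

theorem sinkDarts_sublist (ν : SPTree D) : (ν.sinkDarts G).Sublist (ν.edges.map G.rev) := by
  induction ν with
  | edge d => exact List.Sublist.refl _
  | series a b iha ihb =>
    rw [edges, List.map_append]; exact ihb.trans (List.sublist_append_right _ _)
  | par2 a b iha ihb => rw [edges, List.map_append]; exact iha.append ihb
  | par3 a b c iha ihb ihc =>
    rw [edges, List.map_append, List.map_append]; exact (iha.append ihb).append ihc

theorem rightBoundary_sublist (ν : SPTree D) : ν.rightBoundary.Sublist ν.edges := by
  induction ν with
  | edge d => exact List.Sublist.refl _
  | series a b iha ihb => exact iha.append ihb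
  | par2 a b iha ihb => exact ihb.trans (List.sublist_append_right _ _)
  | par3 a b c iha ihb ihc => exact ihc.trans (List.sublist_append_right _ _)

/-- Not a sublist: the left boundary runs from sink to source, against the order of `edges`. -/
theorem leftBoundary_subperm (ν : SPTree D) :
    (ν.leftBoundary G).Subperm (ν.edges.map G.rev) := by
  induction ν with
  | edge d => exact List.Subperm.refl _
  | series a b iha ihb =>
    rw [edges, List.map_append]
    exact List.perm_append_comm.subperm.trans (iha.append ihb)
  | par2 a b iha ihb =>
    rw [edges, List.map_append]; exact iha.trans (List.sublist_append_left _ _).subperm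
  | par3 a b c iha ihb ihc =>
    rw [edges, List.append_assoc, List.map_append]
    exact iha.trans (List.sublist_append_left _ _).subperm

theorem sourceDarts_ne_nil (ν : SPTree D) : ν.sourceDarts ≠ [] := by
  induction ν <;> simp_all [sourceDarts]

theorem sinkDarts_ne_nil (ν : SPTree D) : ν.sinkDarts G ≠ [] := by
  induction ν <;> simp_all [sinkDarts]

theorem rightBoundary_ne_nil (ν : SPTree D) : ν.rightBoundary ≠ [] := by
  induction ν <;> simp_all [rightBoundary]

theorem leftBoundary_ne_nil (ν : SPTree D) : ν.leftBoundary G ≠ [] := by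
  induction ν <;> simp_all [leftBoundary]

theorem head?_rightBoundary (ν : SPTree D) : ν.rightBoundary.head? = ν.sourceDarts.getLast? := by
  induction ν with
  | edge d => rfl
  | series a b iha ihb =>
    rw [rightBoundary, sourceDarts, List.head?_append_of_ne_nil _ a.rightBoundary_ne_nil, iha]
  | par2 a b iha ihb =>
    rw [rightBoundary, sourceDarts, List.getLast?_append_of_ne_nil _ b.sourceDarts_ne_nil, ihb]
  | par3 a b c iha ihb ihc =>
    rw [rightBoundary, sourceDarts, List.getLast?_append_of_ne_nil _ c.sourceDarts_ne_nil, ihc]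

theorem getLast?_rightBoundary (ν : SPTree D) :
    ν.rightBoundary.getLast?.map G.rev = (ν.sinkDarts G).getLast? := by
  induction ν with
  | edge d => rfl
  | series a b iha ihb =>
    rw [rightBoundary, sinkDarts, List.getLast?_append_of_ne_nil _ b.rightBoundary_ne_nil, ihb]
  | par2 a b iha ihb =>
    rw [rightBoundary, sinkDarts, List.getLast?_append_of_ne_nil _ b.sinkDarts_ne_nil, ihb]
  | par3 a b c iha ihb ihc =>
    rw [rightBoundary, sinkDarts, List.getLast?_append_of_ne_nil _ c.sinkDarts_ne_nil, ihc]

theorem head?_leftBoundary (ν : SPTree D) :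
    (ν.leftBoundary G).head? = (ν.sinkDarts G).head? := by
  induction ν with
  | edge d => rfl
  | series a b iha ihb =>
    rw [leftBoundary, sinkDarts, List.head?_append_of_ne_nil _ b.leftBoundary_ne_nil, ihb]
  | par2 a b iha ihb =>
    rw [leftBoundary, sinkDarts, List.head?_append_of_ne_nil _ a.sinkDarts_ne_nil, iha]
  | par3 a b c iha ihb ihc =>
    rw [leftBoundary, sinkDarts, List.append_assoc,
      List.head?_append_of_ne_nil _ a.sinkDarts_ne_nil, iha]

theorem getLast?_leftBoundary (ν : SPTree D) :
    (ν.leftBoundary G).getLast?.map G.rev = ν.sourceDarts.head? := by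
  induction ν with
  | edge d => simp [leftBoundary, sourceDarts, G.rev_rev]
  | series a b iha ihb =>
    rw [leftBoundary, sourceDarts, List.getLast?_append_of_ne_nil _ a.leftBoundary_ne_nil, iha]
  | par2 a b iha ihb =>
    rw [leftBoundary, sourceDarts, List.head?_append_of_ne_nil _ a.sourceDarts_ne_nil, iha]
  | par3 a b c iha ihb ihc =>
    rw [leftBoundary, sourceDarts, List.append_assoc,
      List.head?_append_of_ne_nil _ a.sourceDarts_ne_nil, iha]

theorem darts_series_perm (a b : SPTree D) :
    ((series a b).darts G).Perm (a.darts G ++ b.darts G) := by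
  classical
  simp only [darts, edges, List.perm_iff_count, List.map_append, List.count_append]
  intro x; omega

theorem darts_par2_perm (a b : SPTree D) :
    ((par2 a b).darts G).Perm (a.darts G ++ b.darts G) :=
  darts_series_perm a b

theorem darts_par3_perm (a b c : SPTree D) :
    ((par3 a b c).darts G).Perm (a.darts G ++ (b.darts G ++ c.darts G)) := by
  classical
  simp only [darts, edges, List.perm_iff_count, List.map_append, List.count_append]
  intro x; omega

/-- Each dart has exactly one origin. This makes the vertex lists free of repetition and identifies
the darts that do not leave a pole. -/
theorem vertices_perm (ν : SPTree D) :
    (ν.sourceDarts ++ ν.sinkDarts G ++ (ν.innerVertices G).flatten).Perm (ν.darts G) := by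
  classical
  induction ν with
  | edge d => simp [sourceDarts, sinkDarts, innerVertices, darts, edges]
  | series a b iha ihb =>
    refine .trans ?_ (darts_series_perm a b).symm
    rw [List.perm_iff_count] at *
    intro x
    have h1 := iha x
    have h2 := ihb x
    simp only [sourceDarts, sinkDarts, innerVertices, List.count_append, List.flatten_append,
      List.flatten_cons, List.flatten_nil, List.count_reverse, List.count_nil] at *
    omega
  | par2 a b iha ihb =>
    refine .trans ?_ (darts_par2_perm a b).symm
    rw [List.perm_iff_count] at *
    intro x
    have h1 := iha x
    have h2 := ihb x
    simp only [sourceDarts, sinkDarts, innerVertices, List.count_append, List.flatten_append] at *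
    omega
  | par3 a b c iha ihb ihc =>
    refine .trans ?_ (darts_par3_perm a b c).symm
    rw [List.perm_iff_count] at *
    intro x
    have h1 := iha x
    have h2 := ihb x
    have h3 := ihc x
    simp only [sourceDarts, sinkDarts, innerVertices, List.count_append, List.flatten_append] at *
    omega

theorem mem_darts_of_mem_edges {ν : SPTree D} {x : D} (h : x ∈ ν.edges) : x ∈ ν.darts G :=
  List.mem_append_left _ h

theorem mem_darts_of_mem_map {ν : SPTree D} {x : D} (h : x ∈ ν.edges.map G.rev) :
    x ∈ ν.darts G :=
  List.mem_append_right _ h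

theorem mem_darts_of_mem_sourceDarts {ν : SPTree D} {x : D} (h : x ∈ ν.sourceDarts) :
    x ∈ ν.darts G :=
  mem_darts_of_mem_edges (ν.sourceDarts_sublist.subset h)

theorem mem_darts_of_mem_sinkDarts {ν : SPTree D} {x : D} (h : x ∈ ν.sinkDarts G) :
    x ∈ ν.darts G :=
  mem_darts_of_mem_map (ν.sinkDarts_sublist.subset h)

theorem rev_mem_darts {ν : SPTree D} {x : D} (h : x ∈ ν.darts G) : G.rev x ∈ ν.darts G := by
  rcases List.mem_append.1 h with h | h
  · exact mem_darts_of_mem_map (List.mem_map_of_mem h)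
  · obtain ⟨y, hy, rfl⟩ := List.mem_map.1 h
    rw [G.rev_rev]
    exact mem_darts_of_mem_edges hy

theorem rev_mem_darts_iff {ν : SPTree D} {x : D} : G.rev x ∈ ν.darts G ↔ x ∈ ν.darts G :=
  ⟨fun h => by simpa [G.rev_rev] using rev_mem_darts h, rev_mem_darts⟩

/-! ### Position of a node in the plane graph -/

/-- The rotations at the vertices of the pertinent graph of `ν` in `G` are those given by `ν`;
each pole has a dart outside the pertinent graph. -/
structure Placed (G : PlaneGraph D) (ν : SPTree D) : Prop where
  inner : ∀ L ∈ ν.innerVertices G, IsCyc G.cw L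
  source : ∃ C, C ≠ [] ∧ IsCyc G.cw (ν.sourceDarts ++ C) ∧ ∀ x ∈ C, x ∉ ν.darts G
  sink : ∃ C, C ≠ [] ∧ IsCyc G.cw ((ν.sinkDarts G).reverse ++ C) ∧ ∀ x ∈ C, x ∉ ν.darts G
  nodup : (ν.darts G).Nodup
  ref_notMem : G.ref ∉ ν.darts G

/-- `a` and `b` are consecutive components of a parallel composition, `a` on the left. -/
structure Adjacent (G : PlaneGraph D) (a b : SPTree D) : Prop where
  left : a.Placed G
  right : b.Placed G
  disjoint : (a.darts G).Disjoint (b.darts G)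
  source : ∃ C, IsCyc G.cw (a.sourceDarts ++ b.sourceDarts ++ C)
  sink : ∃ C, IsCyc G.cw ((b.sinkDarts G).reverse ++ (a.sinkDarts G).reverse ++ C)

/-- At the middle vertex each of the two components supplies the darts outside the other one. -/
theorem Placed.of_series {a b : SPTree D} (h : (series a b).Placed G) :
    a.Placed G ∧ b.Placed G := by
  have hp := darts_series_perm (G := G) a b
  have hn := hp.nodup_iff.1 h.nodup
  obtain ⟨hna, hnb, hd⟩ := List.nodup_append'.1 hn
  have hm : ∀ x, x ∉ (series a b).darts G → x ∉ a.darts G ∧ x ∉ b.darts G := by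
    intro x hx
    rw [hp.mem_iff, List.mem_append] at hx
    exact not_or.1 hx
  have hv : IsCyc G.cw (b.sourceDarts ++ (a.sinkDarts G).reverse) :=
    h.inner _ (by simp [innerVertices])
  obtain ⟨C, hC, hC', hC''⟩ := h.source
  obtain ⟨E, hE, hE', hE''⟩ := h.sink
  refine ⟨⟨fun L hL => h.inner L (by simp [innerVertices, hL]),
    ⟨C, hC, hC', fun x hx => (hm x (hC'' x hx)).1⟩,
    ⟨b.sourceDarts, b.sourceDarts_ne_nil, hv.append_comm,
      fun x hx hx' => hd hx' (mem_darts_of_mem_sourceDarts hx)⟩, hna, (hm _ h.ref_notMem).1⟩,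
    ⟨fun L hL => h.inner L (by simp [innerVertices, hL]),
    ⟨_, by simpa using a.sinkDarts_ne_nil (G := G), hv,
      fun x hx hx' => hd (mem_darts_of_mem_sinkDarts (List.mem_reverse.1 hx)) hx'⟩,
    ⟨E, hE, hE', fun x hx => (hm x (hE'' x hx)).2⟩, hnb, (hm _ h.ref_notMem).2⟩⟩

theorem Placed.of_par3 {a b c : SPTree D} (h : (par3 a b c).Placed G) :
    a.Placed G ∧ b.Placed G ∧ c.Placed G := by
  have hp := darts_par3_perm (G := G) a b c
  have hn := hp.nodup_iff.1 h.nodup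
  obtain ⟨hna, hn', hd⟩ := List.nodup_append'.1 hn
  obtain ⟨hnb, hnc, hd'⟩ := List.nodup_append'.1 hn'
  rw [List.disjoint_append_right] at hd
  obtain ⟨hab, hac⟩ := hd
  have hm : ∀ x, x ∉ (par3 a b c).darts G → x ∉ a.darts G ∧ x ∉ b.darts G ∧ x ∉ c.darts G := by
    intro x hx
    rw [hp.mem_iff, List.mem_append, List.mem_append] at hx
    exact ⟨fun h => hx (.inl h), fun h => hx (.inr (.inl h)), fun h => hx (.inr (.inr h))⟩
  obtain ⟨C, hC, hC', hC''⟩ := h.source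
  obtain ⟨E, hE, hE', hE''⟩ := h.sink
  simp only [sourceDarts, sinkDarts, List.reverse_append, List.append_assoc] at hC' hE'
  have hS : ∀ {t : SPTree D} {x : D}, x ∈ t.sourceDarts → x ∈ t.darts G :=
    mem_darts_of_mem_sourceDarts
  have hK : ∀ {t : SPTree D} {x : D}, x ∈ t.sinkDarts G → x ∈ t.darts G :=
    mem_darts_of_mem_sinkDarts
  refine ⟨⟨fun L hL => h.inner L (by simp [innerVertices, hL]),
    ⟨_, ?_, hC', ?_⟩, ⟨E ++ (c.sinkDarts G).reverse ++ (b.sinkDarts G).reverse, ?_, ?_, ?_⟩,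
      hna, (hm _ h.ref_notMem).1⟩,
    ⟨fun L hL => h.inner L (by simp [innerVertices, hL]),
    ⟨c.sourceDarts ++ C ++ a.sourceDarts, ?_, ?_, ?_⟩,
    ⟨(a.sinkDarts G).reverse ++ E ++ (c.sinkDarts G).reverse, ?_, ?_, ?_⟩,
      hnb, (hm _ h.ref_notMem).2.1⟩,
    ⟨fun L hL => h.inner L (by simp [innerVertices, hL]),
    ⟨C ++ a.sourceDarts ++ b.sourceDarts, ?_, ?_, ?_⟩,
    ⟨_, ?_, hE', ?_⟩, hnc, (hm _ h.ref_notMem).2.2⟩⟩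
  · simp [hC]
  · rintro x hx hxa
    simp only [List.mem_append] at hx
    rcases hx with hx | hx | hx
    · exact hab hxa (hS hx)
    · exact hac hxa (hS hx)
    · exact (hm x (hC'' x hx)).1 hxa
  · simp [hE]
  · have := IsCyc.append_comm (A := (c.sinkDarts G).reverse ++ (b.sinkDarts G).reverse)
      (B := (a.sinkDarts G).reverse ++ E) (by simpa using hE')
    simpa using this
  · rintro x hx hxa
    simp only [List.mem_append, List.mem_reverse] at hx
    rcases hx with (hx | hx) | hx
    · exact (hm x (hE'' x hx)).1 hxa
    · exact hac hxa (hK hx)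
    · exact hab hxa (hK hx)
  · simp [hC]
  · simpa using hC'.append_comm
  · rintro x hx hxb
    simp only [List.mem_append] at hx
    rcases hx with (hx | hx) | hx
    · exact hd' hxb (hS hx)
    · exact (hm x (hC'' x hx)).2.1 hxb
    · exact hab (hS hx) hxb
  · simp [hE]
  · simpa using hE'.append_comm
  · rintro x hx hxb
    simp only [List.mem_append, List.mem_reverse] at hx
    rcases hx with (hx | hx) | hx
    · exact hab (hK hx) hxb
    · exact (hm x (hE'' x hx)).2.1 hxb
    · exact hd' hxb (hK hx)
  · simp [hC]
  · have := IsCyc.append_comm (A := a.sourceDarts ++ b.sourceDarts)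
      (B := c.sourceDarts ++ C) (by simpa using hC')
    simpa using this
  · rintro x hx hxc
    simp only [List.mem_append] at hx
    rcases hx with (hx | hx) | hx
    · exact (hm x (hC'' x hx)).2.2 hxc
    · exact hac (hS hx) hxc
    · exact hd' (hS hx) hxc
  · simp [hE]
  · rintro x hx hxc
    simp only [List.mem_append, List.mem_reverse] at hx
    rcases hx with hx | hx | hx
    · exact hd' (hK hx) hxc
    · exact hac (hK hx) hxc
    · exact (hm x (hE'' x hx)).2.2 hxc

theorem Placed.of_par2 {a b : SPTree D} (h : (par2 a b).Placed G) :
    a.Placed G ∧ b.Placed G := by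
  have hp := darts_par2_perm (G := G) a b
  have hn := hp.nodup_iff.1 h.nodup
  obtain ⟨hna, hnb, hab⟩ := List.nodup_append'.1 hn
  have hm : ∀ x, x ∉ (par2 a b).darts G → x ∉ a.darts G ∧ x ∉ b.darts G := by
    intro x hx
    rw [hp.mem_iff, List.mem_append] at hx
    exact not_or.1 hx
  obtain ⟨C, hC, hC', hC''⟩ := h.source
  obtain ⟨E, hE, hE', hE''⟩ := h.sink
  simp only [sourceDarts, sinkDarts, List.reverse_append, List.append_assoc] at hC' hE'
  have hS : ∀ {t : SPTree D} {x : D}, x ∈ t.sourceDarts → x ∈ t.darts G :=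
    mem_darts_of_mem_sourceDarts
  have hK : ∀ {t : SPTree D} {x : D}, x ∈ t.sinkDarts G → x ∈ t.darts G :=
    mem_darts_of_mem_sinkDarts
  refine ⟨⟨fun L hL => h.inner L (by simp [innerVertices, hL]),
    ⟨_, ?_, hC', ?_⟩, ⟨E ++ (b.sinkDarts G).reverse, ?_, ?_, ?_⟩,
      hna, (hm _ h.ref_notMem).1⟩,
    ⟨fun L hL => h.inner L (by simp [innerVertices, hL]),
    ⟨C ++ a.sourceDarts, ?_, ?_, ?_⟩,
    ⟨_, ?_, hE', ?_⟩, hnb, (hm _ h.ref_notMem).2⟩⟩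
  · simp [hC]
  · rintro x hx hxa
    simp only [List.mem_append] at hx
    rcases hx with hx | hx
    · exact hab hxa (hS hx)
    · exact (hm x (hC'' x hx)).1 hxa
  · simp [hE]
  · simpa using hE'.append_comm
  · rintro x hx hxa
    simp only [List.mem_append, List.mem_reverse] at hx
    rcases hx with hx | hx
    · exact (hm x (hE'' x hx)).1 hxa
    · exact hab hxa (hK hx)
  · simp [hC]
  · simpa using hC'.append_comm
  · rintro x hx hxb
    simp only [List.mem_append] at hx
    rcases hx with hx | hx
    · exact (hm x (hC'' x hx)).2 hxb
    · exact hab (hS hx) hxb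
  · simp [hE]
  · rintro x hx hxb
    simp only [List.mem_append, List.mem_reverse] at hx
    rcases hx with hx | hx
    · exact hab (hK hx) hxb
    · exact (hm x (hE'' x hx)).2 hxb

theorem Placed.adjacent_par2 {a b : SPTree D} (h : (par2 a b).Placed G) : Adjacent G a b := by
  have hn := (darts_par2_perm (G := G) a b).nodup_iff.1 h.nodup
  obtain ⟨C, -, hC', -⟩ := h.source
  obtain ⟨E, -, hE', -⟩ := h.sink
  simp only [sourceDarts, sinkDarts, List.reverse_append] at hC' hE'
  exact ⟨h.of_par2.1, h.of_par2.2, (List.nodup_append'.1 hn).2.2, ⟨C, hC'⟩, ⟨E, hE'⟩⟩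

theorem Placed.adjacent_par3_left {a b c : SPTree D} (h : (par3 a b c).Placed G) :
    Adjacent G a b := by
  have hn := (darts_par3_perm (G := G) a b c).nodup_iff.1 h.nodup
  have hd := (List.nodup_append'.1 hn).2.2
  rw [List.disjoint_append_right] at hd
  obtain ⟨C, -, hC', -⟩ := h.source
  obtain ⟨E, -, hE', -⟩ := h.sink
  simp only [sourceDarts, sinkDarts, List.reverse_append, List.append_assoc] at hC' hE'
  exact ⟨h.of_par3.1, h.of_par3.2.1, hd.1, ⟨c.sourceDarts ++ C, by simpa using hC'⟩,
    ⟨E ++ (c.sinkDarts G).reverse, by simpa using hE'.append_comm⟩⟩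

theorem Placed.adjacent_par3_right {a b c : SPTree D} (h : (par3 a b c).Placed G) :
    Adjacent G b c := by
  have hn := (darts_par3_perm (G := G) a b c).nodup_iff.1 h.nodup
  have hd := (List.nodup_append'.1 (List.nodup_append'.1 hn).2.1).2.2
  obtain ⟨C, -, hC', -⟩ := h.source
  obtain ⟨E, -, hE', -⟩ := h.sink
  simp only [sourceDarts, sinkDarts, List.reverse_append, List.append_assoc] at hC' hE'
  exact ⟨h.of_par3.2.1, h.of_par3.2.2, hd, ⟨C ++ a.sourceDarts, by simpa using hC'.append_comm⟩,
    ⟨(a.sinkDarts G).reverse ++ E, by simpa using hE'⟩⟩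

theorem IsNode.placed {ν T : SPTree D} (h : IsNode ν T) (hT : T.Placed G) : ν.Placed G := by
  induction h with
  | refl => exact hT
  | series_left _ ih => exact ih hT.of_series.1
  | series_right _ ih => exact ih hT.of_series.2
  | par2_left _ ih => exact ih hT.of_par2.1
  | par2_right _ ih => exact ih hT.of_par2.2
  | par3_left _ ih => exact ih hT.of_par3.1
  | par3_center _ ih => exact ih hT.of_par3.2.1
  | par3_right _ ih => exact ih hT.of_par3.2.2

/-- At the root, the dart outside the pertinent graph at each pole is that of the reference edge. -/
theorem placed_of_hasSPTree {T : SPTree D} (h : G.HasSPTree T) : T.Placed G := by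
  have hn := h.nodup
  have hp : ((G.ref :: T.edges) ++ (G.ref :: T.edges).map G.rev).Perm
      ([G.ref, G.rev G.ref] ++ T.darts G) := by
    classical
    simp only [darts, List.perm_iff_count, List.map_cons, List.count_append, List.count_cons,
      List.count_nil]
    intro x; omega
  rw [hp.nodup_iff] at hn
  obtain ⟨-, hn', hd⟩ := List.nodup_append'.1 hn
  have hr : G.ref ∉ T.darts G := fun h => hd (by simp) h
  have hr' : G.rev G.ref ∉ T.darts G := fun h => hd (by simp) h
  have hv := (vertices_perm (G := G) T).nodup_iff.2 hn'
  obtain ⟨hv1, hv2, -⟩ := List.nodup_append'.1 hv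
  obtain ⟨hs, ht, -⟩ := List.nodup_append'.1 hv1
  refine ⟨fun L hL => ⟨(List.nodup_flatten.1 hv2).1 L hL, h.rotation L (by simp [hL])⟩,
    ⟨[G.ref], by simp, ⟨?_, h.rotation _ (by simp)⟩, by simpa using hr⟩,
    ⟨[G.rev G.ref], by simp, ?_, by simpa using hr'⟩, hn', hr⟩
  · refine List.nodup_append'.2 ⟨hs, by simp, ?_⟩
    simpa using fun h => hr (mem_darts_of_mem_sourceDarts h)
  · refine IsCyc.append_comm (A := [G.rev G.ref]) ⟨?_, h.rotation _ (by simp)⟩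
    refine List.nodup_append'.2 ⟨by simp, by simpa using ht, ?_⟩
    simpa using fun h => hr' (mem_darts_of_mem_sinkDarts h)

/-! ### Faces -/

/-- At the middle vertex of a series composition, the rightmost source dart of `b` immediately
precedes the rightmost sink dart of `a` clockwise, so the face passes between them. -/
theorem Placed.isChain_rightBoundary {ν : SPTree D} (h : ν.Placed G) :
    ν.rightBoundary.IsChain (fun x y => G.faceNext x = y) := by
  induction ν with
  | edge d => simp [rightBoundary]
  | series a b iha ihb =>
    rw [rightBoundary, List.isChain_append]
    refine ⟨iha h.of_series.1, ihb h.of_series.2, fun x hx y hy => ?_⟩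
    have hv : IsCyc G.cw (b.sourceDarts ++ (a.sinkDarts G).reverse) :=
      h.inner _ (by simp [innerVertices])
    refine G.faceNext_eq (hv.apply_getLast ?_ ?_)
    · rw [← head?_rightBoundary]; exact hy
    · rw [List.head?_reverse, ← getLast?_rightBoundary, Option.mem_def.1 hx]; rfl
  | par2 a b iha ihb => exact ihb h.of_par2.2
  | par3 a b c iha ihb ihc => exact ihc h.of_par3.2.2

theorem Placed.isChain_leftBoundary {ν : SPTree D} (h : ν.Placed G) :
    (ν.leftBoundary G).IsChain (fun x y => G.faceNext x = y) := by
  induction ν with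
  | edge d => simp [leftBoundary]
  | series a b iha ihb =>
    rw [leftBoundary, List.isChain_append]
    refine ⟨ihb h.of_series.2, iha h.of_series.1, fun x hx y hy => ?_⟩
    have hv : IsCyc G.cw (b.sourceDarts ++ (a.sinkDarts G).reverse) :=
      h.inner _ (by simp [innerVertices])
    refine G.faceNext_eq (hv.append_comm.apply_getLast ?_ ?_)
    · rw [List.getLast?_reverse, ← head?_leftBoundary]; exact hy
    · rw [← getLast?_leftBoundary (G := G), Option.mem_def.1 hx]; rfl
  | par2 a b iha ihb => exact iha h.of_par2.1
  | par3 a b c iha ihb ihc => exact iha h.of_par3.1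

theorem Placed.nodup_rightBoundary {ν : SPTree D} (h : ν.Placed G) : ν.rightBoundary.Nodup :=
  ν.rightBoundary_sublist.nodup (List.nodup_append'.1 h.nodup).1

theorem Placed.nodup_leftBoundary {ν : SPTree D} (h : ν.Placed G) : (ν.leftBoundary G).Nodup := by
  obtain ⟨L, hL, hL'⟩ := ν.leftBoundary_subperm (G := G)
  exact hL.nodup_iff.1 (hL'.nodup (List.nodup_append'.1 h.nodup).2.1)

/-- The face between two consecutive components of a parallel composition. -/
theorem Adjacent.isCyc {a b : SPTree D} (h : Adjacent G a b) :
    IsCyc G.faceNext (a.rightBoundary ++ b.leftBoundary G) := by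
  obtain ⟨C, hC⟩ := h.source
  obtain ⟨E, hE⟩ := h.sink
  obtain ⟨x, hx⟩ := Option.ne_none_iff_exists'.1
    (mt List.head?_eq_none_iff.1 a.rightBoundary_ne_nil)
  obtain ⟨x', hx'⟩ := Option.ne_none_iff_exists'.1
    (mt List.getLast?_eq_none_iff.1 a.rightBoundary_ne_nil)
  obtain ⟨y, hy⟩ := Option.ne_none_iff_exists'.1
    (mt List.head?_eq_none_iff.1 (b.leftBoundary_ne_nil (G := G)))
  obtain ⟨y', hy'⟩ := Option.ne_none_iff_exists'.1
    (mt List.getLast?_eq_none_iff.1 (b.leftBoundary_ne_nil (G := G)))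
  have hxs := a.head?_rightBoundary.symm.trans hx
  have hxt := (a.getLast?_rightBoundary (G := G)).symm
  have hyt := (b.head?_leftBoundary (G := G)).symm.trans hy
  have hys := (b.getLast?_leftBoundary (G := G)).symm
  rw [hx', Option.map_some] at hxt
  rw [hy', Option.map_some] at hys
  -- The two boundaries are joined at the poles, where the rotation leaves no dart between `a` and
  -- `b`.
  have e1 : G.faceNext y' = x := by
    refine G.faceNext_eq (IsCyc.apply_getLast (A := a.sourceDarts) (B := b.sourceDarts ++ C)
      (by simpa using hC) hxs ?_)
    rw [List.head?_append_of_ne_nil _ b.sourceDarts_ne_nil, hys]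
  have e2 : G.faceNext x' = y := by
    refine G.faceNext_eq (IsCyc.apply_getLast (A := (b.sinkDarts G).reverse)
      (B := (a.sinkDarts G).reverse ++ E) (by simpa using hE) ?_ ?_)
    · rw [List.getLast?_reverse, hyt]
    · rw [List.head?_append_of_ne_nil _ (by simpa using a.sinkDarts_ne_nil (G := G)),
        List.head?_reverse, hxt]
  refine isCyc_of_isChain (x := x) (y := y') ?_ ?_ ?_ ?_ e1
  · refine List.nodup_append'.2 ⟨h.left.nodup_rightBoundary, h.right.nodup_leftBoundary, ?_⟩
    intro z hz hz'
    exact h.disjoint (mem_darts_of_mem_edges (a.rightBoundary_sublist.subset hz))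
      (mem_darts_of_mem_map (b.leftBoundary_subperm.subset hz'))
  · rw [List.isChain_append]
    refine ⟨h.left.isChain_rightBoundary, h.right.isChain_leftBoundary, fun z hz w hw => ?_⟩
    rw [Option.mem_def] at hz hw
    rw [hx'] at hz; rw [hy] at hw
    cases hz; cases hw
    exact e2
  · rw [List.head?_append_of_ne_nil _ a.rightBoundary_ne_nil, hx]
  · rw [List.getLast?_append_of_ne_nil _ b.leftBoundary_ne_nil, hy']

end SPTree

/-! ### Orthogonal representations as integer vectors -/

section Rep

variable {D : Type*} [Fintype D] [DecidableEq D] {G : PlaneGraph D}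

/-- The angles `a` and the net numbers `v` of right bends of an orthogonal representation. -/
structure IsRep (G : PlaneGraph D) (a v : D → ℤ) : Prop where
  ang_mem : ∀ d, 1 ≤ a d ∧ a d ≤ 4
  antisymm : ∀ d, v (G.rev d) = -v d
  vertex : ∀ d, ∑ x ∈ Finset.univ.filter (fun x => G.cw.SameCycle d x), a x = 4
  face : ∀ d, ∑ x ∈ Finset.univ.filter (fun x => G.faceNext.SameCycle d x), (2 - a x + v x)
      = if G.faceNext.SameCycle d G.ref then -4 else 4

theorem IsRep.sum_vertex {a v : D → ℤ} (h : IsRep G a v) {L : List D} (hL : IsCyc G.cw L)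
    (hne : L ≠ []) : (L.map a).sum = 4 := by
  obtain ⟨d, hd⟩ := List.exists_mem_of_ne_nil L hne
  rw [← hL.sum_orbit hd, h.vertex d]

theorem IsRep.sum_face {a v : D → ℤ} (h : IsRep G a v) {L : List D} (hL : IsCyc G.faceNext L)
    (hne : L ≠ []) (hr : G.ref ∉ L) : (L.map fun x => 2 - a x + v x).sum = 4 := by
  obtain ⟨d, hd⟩ := List.exists_mem_of_ne_nil L hne
  rw [← hL.sum_orbit hd, h.face d, if_neg]
  rwa [hL.sameCycle_iff hd]

namespace SPTree

/-- The turns, at corners and bends, of the faces along the right boundary. -/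
def rightTurn (a v : D → ℤ) (ν : SPTree D) : ℤ :=
  (ν.rightBoundary.map fun x => 2 - a x + v x).sum

/-- The turns, at corners and bends, of the faces along the left boundary. -/
def leftTurn (G : PlaneGraph D) (a v : D → ℤ) (ν : SPTree D) : ℤ :=
  ((ν.leftBoundary G).map fun x => 2 - a x + v x).sum

theorem Adjacent.turn_add {s t : SPTree D} (h : Adjacent G s t) {a v : D → ℤ}
    (hav : IsRep G a v) : s.rightTurn a v + t.leftTurn G a v = 4 := by
  rw [rightTurn, leftTurn, ← List.sum_append, ← List.map_append]
  refine hav.sum_face h.isCyc (by simp [s.rightBoundary_ne_nil]) ?_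
  rw [List.mem_append, not_or]
  exact ⟨fun hx => h.left.ref_notMem (mem_darts_of_mem_edges (s.rightBoundary_sublist.subset hx)),
    fun hx => h.right.ref_notMem (mem_darts_of_mem_map (t.leftBoundary_subperm.subset hx))⟩

/-- Turning number of the outer contour. Inductively, a series composition uses the angle sum 4 at
the middle vertex, and a parallel composition uses the sum 4 of each face between children. -/
theorem Placed.turn_add {ν : SPTree D} (h : ν.Placed G) {a v : D → ℤ} (hav : IsRep G a v) :
    ν.rightTurn a v + ν.leftTurn G a v
      = 4 - (ν.sourceDarts.map a).sum - ((ν.sinkDarts G).map a).sum := by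
  induction ν with
  | edge d =>
    simp [rightTurn, leftTurn, rightBoundary, leftBoundary, sourceDarts, sinkDarts, hav.antisymm]
    ring
  | series s t ihs iht =>
    have h1 := ihs h.of_series.1
    have h2 := iht h.of_series.2
    have h3 := hav.sum_vertex (h.inner (t.sourceDarts ++ (s.sinkDarts G).reverse)
      (by simp [innerVertices])) (by simp [t.sourceDarts_ne_nil])
    simp only [rightTurn, leftTurn, rightBoundary, leftBoundary, sourceDarts, sinkDarts,
      List.map_append, List.sum_append, List.map_reverse, List.sum_reverse] at *
    linarith
  | par2 s t ihs iht =>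
    have h1 := ihs h.of_par2.1
    have h2 := iht h.of_par2.2
    have h3 := h.adjacent_par2.turn_add hav
    simp only [rightTurn, leftTurn, rightBoundary, leftBoundary, sourceDarts, sinkDarts,
      List.map_append, List.sum_append] at *
    linarith
  | par3 s t r ihs iht ihr =>
    have h1 := ihs h.of_par3.1
    have h2 := iht h.of_par3.2.1
    have h3 := ihr h.of_par3.2.2
    have h4 := h.adjacent_par3_left.turn_add hav
    have h5 := h.adjacent_par3_right.turn_add hav
    simp only [rightTurn, leftTurn, rightBoundary, leftBoundary, sourceDarts, sinkDarts,
      List.map_append, List.sum_append] at *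
    linarith

/-- The left turn of `t` is eliminated between the condition for the common face and the contour
identity for `t`. -/
theorem Adjacent.rightTurn_eq {s t : SPTree D} (h : Adjacent G s t) {a v : D → ℤ}
    (hav : IsRep G a v) : s.rightTurn a v
      = t.rightTurn a v + (t.sourceDarts.map a).sum + ((t.sinkDarts G).map a).sum := by
  have h1 := h.turn_add hav
  have h2 := h.right.turn_add hav
  linarith

end SPTree

namespace OrthRep

/-- The angles, as integers. -/
def angle (H : OrthRep G) (d : D) : ℤ := H.ang d

/-- Right bends minus left bends. -/
def netBend (H : OrthRep G) (d : D) : ℤ := ((H.bends d).map Turn.val).sum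

theorem cast_sum_ang (H : OrthRep G) (L : List D) :
    (((L.map H.ang).sum : ℕ) : ℤ) = (L.map H.angle).sum := by
  rw [Nat.cast_list_sum, List.map_map]; rfl

theorem isRep (H : OrthRep G) : IsRep G H.angle H.netBend where
  ang_mem d := by have := H.ang_mem d; simp only [angle]; omega
  antisymm d := by
    rw [netBend, H.bends_rev, List.map_reverse, List.sum_reverse, List.map_map, netBend]
    induction H.bends d with
    | nil => simp
    | cons t l ih =>
      rw [List.map_cons, List.sum_cons, ih, List.map_cons, List.sum_cons]
      cases t <;> simp [Turn.flip, Turn.val] <;> ring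
  vertex d := by simp only [angle]; exact_mod_cast H.H1 d
  face d := H.H2 d

theorem abs_netBend_le (H : OrthRep G) (d : D) : |H.netBend d| ≤ (H.bends d).length := by
  rw [netBend]
  induction H.bends d with
  | nil => simp
  | cons t l ih =>
    rw [List.map_cons, List.sum_cons, List.length_cons]
    refine (abs_add_le _ _).trans ?_
    have : |t.val| = 1 := by cases t <;> simp [Turn.val]
    push_cast
    linarith

end OrthRep

/-- A list of equal turns with prescribed sum. -/
def turnsOf (k : ℤ) : List Turn := List.replicate k.natAbs (if 0 < k then Turn.right else Turn.left)

theorem turnsOf_neg (k : ℤ) : turnsOf (-k) = ((turnsOf k).map Turn.flip).reverse := by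
  rw [turnsOf, turnsOf, List.map_replicate, List.reverse_replicate, Int.natAbs_neg]
  rcases lt_trichotomy k 0 with h | rfl | h
  · rw [if_pos (by omega), if_neg (by omega)]; rfl
  · rfl
  · rw [if_neg (by omega), if_pos h]; rfl

theorem sum_turnsOf (k : ℤ) : ((turnsOf k).map Turn.val).sum = k := by
  rw [turnsOf, List.map_replicate, List.sum_replicate]
  split_ifs with h
  · simp [Turn.val, abs_of_pos h]
  · simp [Turn.val, abs_of_nonpos (not_lt.1 h)]

theorem length_turnsOf (k : ℤ) : ((turnsOf k).length : ℤ) = |k| := by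
  rw [turnsOf, List.length_replicate]; simp

/-- Realising `v` by equal turns on each edge attains the lower bound of `OrthRep.abs_netBend_le`.
-/
theorem IsRep.exists_orthRep {a v : D → ℤ} (h : IsRep G a v) :
    ∃ H : OrthRep G, H.angle = a ∧ H.netBend = v ∧ ∀ d, ((H.bends d).length : ℤ) = |v d| := by
  have ha : ∀ d, ((a d).toNat : ℤ) = a d := fun d => by have := h.ang_mem d; omega
  refine ⟨⟨fun d => (a d).toNat, fun d => turnsOf (v d), ?_, ?_, ?_, ?_⟩, ?_, ?_, ?_⟩
  · intro d; have := h.ang_mem d; omega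
  · intro d; rw [h.antisymm, turnsOf_neg]
  · intro d; have := h.vertex d; zify; simpa only [ha] using this
  · intro d; simpa only [ha, sum_turnsOf] using h.face d
  · funext d; exact ha d
  · funext d; exact sum_turnsOf _
  · intro d; exact length_turnsOf _

/-! ### Paths and spirality -/

namespace SPTree

theorem exists_isPath {D : Type*} (ν : SPTree D) : ∃ P, ν.IsPath P := by
  induction ν with
  | edge d => exact ⟨_, .edge d⟩
  | series a b iha ihb =>
    obtain ⟨P, hP⟩ := iha
    obtain ⟨Q, hQ⟩ := ihb
    exact ⟨_, hP.series hQ⟩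
  | par2 a b iha ihb => obtain ⟨P, hP⟩ := iha; exact ⟨_, .par2_left hP⟩
  | par3 a b c iha ihb ihc => obtain ⟨P, hP⟩ := iha; exact ⟨_, .par3_left hP⟩

end SPTree

theorem OrthRep.pathTurn_append (H : OrthRep G) (P Q : List D) (d e : D) :
    H.pathTurn ((P ++ [d]) ++ (e :: Q))
      = H.pathTurn (P ++ [d]) + H.vertexTurn d e + H.pathTurn (e :: Q) := by
  induction P with
  | nil => simp [OrthRep.pathTurn]
  | cons x P ih =>
    cases P with
    | nil => simp [OrthRep.pathTurn] at ih ⊢; linarith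
    | cons y P => simp [OrthRep.pathTurn] at ih ⊢; linarith

/-- The turn of a path does not depend on the path, up to the angles at the poles. -/
theorem SPTree.IsPath.pathTurn_eq {ν : SPTree D} {P : List D} (hP : ν.IsPath P)
    (h : ν.Placed G) (H : OrthRep G) :
    ∃ d e A B A' B', P.head? = some d ∧ P.getLast? = some e ∧ ν.sourceDarts = A ++ d :: B ∧
      ν.sinkDarts G = A' ++ G.rev e :: B' ∧
      H.pathTurn P = ν.rightTurn H.angle H.netBend - 2 + ((d :: B).map H.angle).sum
        + (B'.map H.angle).sum := by
  -- `rightTurn` also counts the corner at the source, which is not a turn of the path. The `-2` and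
  -- the angle sums correct for it and measure how far the path is from the right boundary at the
  -- two poles.
  induction hP with
  | edge d =>
    exact ⟨d, d, [], [], [], [], rfl, rfl, rfl, rfl, by
      simp [OrthRep.pathTurn, rightTurn, rightBoundary, OrthRep.netBend]; ring⟩
  | @series a b P Q hP hQ ihP ihQ =>
    obtain ⟨d, e, A, B, A', B', hd, he, hs, ht, hturn⟩ := ihP h.of_series.1
    obtain ⟨f, g, X, Y, X', Y', hf, hg, hs', ht', hturn'⟩ := ihQ h.of_series.2
    obtain ⟨P', rfl⟩ := List.getLast?_eq_some_iff.1 he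
    obtain ⟨Q', rfl⟩ : ∃ Q', Q = f :: Q' := by
      cases Q with
      | nil => simp at hf
      | cons w B => exact ⟨B, by simpa using hf⟩
    refine ⟨d, g, A, B, X', Y', by rw [List.head?_append_of_ne_nil _ (by simp), hd],
      by rw [List.getLast?_append_of_ne_nil _ (by simp), hg], hs, ht', ?_⟩
    have hv : IsCyc G.cw (b.sourceDarts ++ (a.sinkDarts G).reverse) :=
      h.inner _ (by simp [innerVertices])
    -- The angle to the right of the path at the middle vertex consists of the corners right of `f`
    -- in `b` and right of `e` in `a`.
    have hang : H.cwAngle f (G.rev e) = (((f :: Y) ++ B'.reverse).map H.ang).sum := by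
      refine cwAngle_eq_sum H (A := X) (B := A'.reverse) ?_ (by simp)
      rw [hs', ht] at hv
      simpa using hv
    have hang' : (H.cwAngle f (G.rev e) : ℤ)
        = ((f :: Y).map H.angle).sum + (B'.map H.angle).sum := by
      rw [hang, H.cast_sum_ang, List.map_append, List.sum_append, List.map_reverse,
        List.sum_reverse]
    rw [OrthRep.pathTurn_append, hturn, hturn', OrthRep.vertexTurn, hang']
    simp only [rightTurn, rightBoundary, List.map_append, List.sum_append]
    ring
  | @par2_left a b P hP ih =>
    obtain ⟨d, e, A, B, A', B', hd, he, hs, ht, hturn⟩ := ih h.of_par2.1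
    refine ⟨d, e, A, B ++ b.sourceDarts, A', B' ++ b.sinkDarts G, hd, he, by
      simp [sourceDarts, hs], by simp [sinkDarts, ht], ?_⟩
    -- Passing from `a` to the boundary of `b` crosses one inner face; the pole angles of `b`
    -- compensate.
    have := h.adjacent_par2.rightTurn_eq H.isRep
    rw [hturn, this]
    simp only [rightTurn, rightBoundary, List.map_append, List.sum_append, List.map_cons,
      List.sum_cons]
    ring
  | @par2_right a b P hP ih =>
    obtain ⟨d, e, A, B, A', B', hd, he, hs, ht, hturn⟩ := ih h.of_par2.2
    exact ⟨d, e, a.sourceDarts ++ A, B, a.sinkDarts G ++ A', B', hd, he, by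
      simp [sourceDarts, hs], by simp [sinkDarts, ht], hturn⟩
  | @par3_left a b c P hP ih =>
    obtain ⟨d, e, A, B, A', B', hd, he, hs, ht, hturn⟩ := ih h.of_par3.1
    refine ⟨d, e, A, B ++ b.sourceDarts ++ c.sourceDarts, A',
      B' ++ b.sinkDarts G ++ c.sinkDarts G, hd, he, by
      simp [sourceDarts, hs], by simp [sinkDarts, ht], ?_⟩
    have h1 := h.adjacent_par3_left.rightTurn_eq H.isRep
    have h2 := h.adjacent_par3_right.rightTurn_eq H.isRep
    rw [hturn, h1, h2]
    simp only [rightTurn, rightBoundary, List.map_append, List.sum_append, List.map_cons,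
      List.sum_cons]
    ring
  | @par3_center a b c P hP ih =>
    obtain ⟨d, e, A, B, A', B', hd, he, hs, ht, hturn⟩ := ih h.of_par3.2.1
    refine ⟨d, e, a.sourceDarts ++ A, B ++ c.sourceDarts, a.sinkDarts G ++ A',
      B' ++ c.sinkDarts G, hd, he, by
      simp [sourceDarts, hs], by simp [sinkDarts, ht], ?_⟩
    have h2 := h.adjacent_par3_right.rightTurn_eq H.isRep
    rw [hturn, h2]
    simp only [rightTurn, rightBoundary, List.map_append, List.sum_append, List.map_cons,
      List.sum_cons]
    ring
  | @par3_right a b c P hP ih =>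
    obtain ⟨d, e, A, B, A', B', hd, he, hs, ht, hturn⟩ := ih h.of_par3.2.2
    exact ⟨d, e, a.sourceDarts ++ b.sourceDarts ++ A, B, a.sinkDarts G ++ b.sinkDarts G ++ A', B',
      hd, he, by simp [sourceDarts, hs], by simp [sinkDarts, ht], hturn⟩

end Rep

/-! ### Components with one dart at each pole: restriction and exchange of representations. -/

section Component

variable {D : Type*} {G : PlaneGraph D}

theorem exists_pred_of_isChain {R : D → D → Prop} {L : List D} {h z : D} (hc : L.IsChain R)
    (hh : L.head? = some h) (hz : z ∈ L) (hzh : z ≠ h) : ∃ w ∈ L, R w z := by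
  obtain ⟨A, B, rfl⟩ := List.append_of_mem hz
  cases A using List.reverseRecOn with
  | nil => simp at hh; exact absurd hh hzh
  | append_singleton A w =>
    refine ⟨w, by simp, ?_⟩
    rw [List.isChain_append] at hc
    exact hc.2.2 w (by simp) z (by simp)

theorem sameCycle_of_isChain {π : Equiv.Perm D} {L : List D}
    (hc : L.IsChain (fun x y => π x = y)) : ∀ x ∈ L, ∀ y ∈ L, π.SameCycle x y := by
  have key : ∀ (M : List D) (h : D), (h :: M).IsChain (fun x y => π x = y) →
      ∀ x ∈ h :: M, π.SameCycle h x := by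
    intro M
    induction M with
    | nil => intro h _ x hx; rw [List.mem_singleton.1 hx]
    | cons w M ih =>
      intro h hc x hx
      rw [List.isChain_cons_cons] at hc
      rcases List.mem_cons.1 hx with rfl | hx
      · exact Equiv.Perm.SameCycle.refl _ _
      · refine Equiv.Perm.SameCycle.trans ?_ (ih w hc.2 x hx)
        exact ⟨1, by simpa using hc.1⟩
  cases L with
  | nil => simp
  | cons h M => exact fun x hx y hy => (key M h hc x hx).symm.trans (key M h hc y hy)

namespace SPTree

/-- A component whose poles have degree one in it; `d` and `e` are its darts at the poles. -/
structure Pendant (G : PlaneGraph D) (μ : SPTree D) (d e : D) : Prop where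
  placed : μ.Placed G
  source : μ.sourceDarts = [d]
  sink : μ.sinkDarts G = [e]

variable {μ : SPTree D} {d e : D}

theorem Pendant.mem_edges (h : μ.Pendant G d e) : d ∈ μ.edges :=
  μ.sourceDarts_sublist.subset (by simp [h.source])

theorem Pendant.mem_map (h : μ.Pendant G d e) : e ∈ μ.edges.map G.rev :=
  (μ.sinkDarts_sublist (G := G)).subset (by simp [h.sink])

theorem Pendant.head_rightBoundary (h : μ.Pendant G d e) : μ.rightBoundary.head? = some d := by
  rw [head?_rightBoundary, h.source]; rfl

theorem Pendant.head_leftBoundary (h : μ.Pendant G d e) :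
    (μ.leftBoundary G).head? = some e := by
  rw [head?_leftBoundary, h.sink]; rfl

theorem Pendant.mem_rightBoundary (h : μ.Pendant G d e) : d ∈ μ.rightBoundary :=
  List.mem_of_mem_head? h.head_rightBoundary

theorem Pendant.rev_mem_rightBoundary (h : μ.Pendant G d e) : G.rev e ∈ μ.rightBoundary := by
  have := μ.getLast?_rightBoundary (G := G)
  rw [h.sink, List.getLast?_singleton, Option.map_eq_some_iff] at this
  obtain ⟨x, hx, rfl⟩ := this
  rw [G.rev_rev]
  exact List.mem_of_mem_getLast? hx

theorem Pendant.rev_mem_leftBoundary (h : μ.Pendant G d e) : G.rev d ∈ μ.leftBoundary G := by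
  have := μ.getLast?_leftBoundary (G := G)
  rw [h.source, List.head?_singleton, Option.map_eq_some_iff] at this
  obtain ⟨x, hx, rfl⟩ := this
  rw [G.rev_rev]
  exact List.mem_of_mem_getLast? hx

theorem Placed.disjoint_edges (h : μ.Placed G) : μ.edges.Disjoint (μ.edges.map G.rev) :=
  (List.nodup_append'.1 h.nodup).2.2

theorem Placed.nodup_edges (h : μ.Placed G) : μ.edges.Nodup :=
  (List.nodup_append'.1 h.nodup).1

theorem Pendant.mem_flatten_iff (h : μ.Pendant G d e) (x : D) :
    x ∈ (μ.innerVertices G).flatten ↔ x ∈ μ.darts G ∧ x ≠ d ∧ x ≠ e := by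
  have hp := μ.vertices_perm (G := G)
  rw [h.source, h.sink] at hp
  have hn := hp.nodup_iff.2 h.placed.nodup
  have hm := hp.mem_iff (a := x)
  simp only [List.cons_append, List.nil_append, List.nodup_cons, List.mem_cons, not_or] at hn hm
  rw [← hm]
  constructor
  · intro hx
    exact ⟨.inr (.inr hx), fun h => hn.1.2 (h ▸ hx), fun h => hn.2.1 (h ▸ hx)⟩
  · rintro ⟨h1 | h1 | h1, h2, h3⟩
    · exact absurd h1 h2
    · exact absurd h1 h3
    · exact h1

theorem Pendant.cw_mem (h : μ.Pendant G d e) {x : D} (hx : x ∈ (μ.innerVertices G).flatten) :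
    G.cw x ∈ (μ.innerVertices G).flatten ∧ G.cw.symm x ∈ (μ.innerVertices G).flatten := by
  obtain ⟨L, hL, hx⟩ := List.mem_flatten.1 hx
  have := h.placed.inner L hL
  exact ⟨List.mem_flatten.2 ⟨L, hL, this.apply_mem hx⟩,
    List.mem_flatten.2 ⟨L, hL, this.symm_apply_mem hx⟩⟩

variable [Fintype D] [DecidableEq D]

/-- All darts of the component except `d` and `e` lie in full vertex orbits inside it, and `p`
vanishes on these two. -/
theorem Pendant.vertex_restrict (h : μ.Pendant G d e) {p : D → ℤ} (hp : OrbitNull G.cw p)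
    (hd : p d = 0) (he : p e = 0) :
    OrbitNull G.cw (fun x => if x ∈ μ.darts G then p x else 0) := by
  have := hp.restrict (p := fun x => x ∈ (μ.innerVertices G).flatten)
    fun x hx => (h.cw_mem hx).1
  convert this using 2 with x
  simp only [h.mem_flatten_iff]
  by_cases h1 : x = d
  · subst h1; simp [hd]
  by_cases h2 : x = e
  · subst h2; simp [he]
  simp [h1, h2]

/-- Restricting a change of face turns to a component: only the boundaries matter. -/
theorem Pendant.face_restrict (h : μ.Pendant G d e) {g : D → ℤ} (hg : OrbitNull G.faceNext g)
    (hr : (μ.rightBoundary.map g).sum = 0) (hl : ((μ.leftBoundary G).map g).sum = 0) :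
    OrbitNull G.faceNext (fun x => if x ∈ μ.darts G then g x else 0) := by
  -- Darts off both boundaries form whole faces inside the component; each boundary is a piece of
  -- one face and has sum zero by itself.
  have h1 := hg.restrict (p := fun x => x ∈ μ.darts G ∧ x ∉ μ.rightBoundary ∧
      x ∉ μ.leftBoundary G) (by
    rintro x ⟨hx, hxr, hxl⟩
    have hx1 : G.rev x ≠ d := by
      rintro rfl
      exact hxl (by simpa [G.rev_rev] using h.rev_mem_leftBoundary)
    have hx2 : G.rev x ≠ e := by
      rintro rfl
      exact hxr (by simpa [G.rev_rev] using h.rev_mem_rightBoundary)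
    have hI : G.faceNext x ∈ (μ.innerVertices G).flatten :=
      (h.cw_mem ((h.mem_flatten_iff _).2 ⟨rev_mem_darts hx, hx1, hx2⟩)).2
    have hI' := (h.mem_flatten_iff _).1 hI
    refine ⟨hI'.1, fun hm => ?_, fun hm => ?_⟩
    · obtain ⟨w, hw, hwx⟩ := exists_pred_of_isChain h.placed.isChain_rightBoundary
        h.head_rightBoundary hm hI'.2.1
      exact hxr (G.faceNext.injective hwx ▸ hw)
    · obtain ⟨w, hw, hwx⟩ := exists_pred_of_isChain h.placed.isChain_leftBoundary
        h.head_leftBoundary hm hI'.2.2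
      exact hxl (G.faceNext.injective hwx ▸ hw))
  have h2 := orbitNull_of_list h.placed.nodup_rightBoundary
    (sameCycle_of_isChain h.placed.isChain_rightBoundary) hr
  have h3 := orbitNull_of_list h.placed.nodup_leftBoundary
    (sameCycle_of_isChain h.placed.isChain_leftBoundary) hl
  convert (h1.add h2).add h3 using 2 with x
  have hr' : x ∈ μ.rightBoundary → x ∈ μ.edges := fun hx => μ.rightBoundary_sublist.subset hx
  have hl' : x ∈ μ.leftBoundary G → x ∈ μ.edges.map G.rev :=
    fun hx => μ.leftBoundary_subperm.subset hx
  by_cases hxr : x ∈ μ.rightBoundary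
  · have hxl : x ∉ μ.leftBoundary G := fun hx => h.placed.disjoint_edges (hr' hxr) (hl' hx)
    simp [hxr, hxl, mem_darts_of_mem_edges (hr' hxr)]
  · by_cases hxl : x ∈ μ.leftBoundary G
    · simp [hxr, hxl, mem_darts_of_mem_map (hl' hxl)]
    · simp [hxr, hxl]

end SPTree

variable [Fintype D] [DecidableEq D] {a v a' v' : D → ℤ}

theorem IsRep.add (h : IsRep G a v) {p q : D → ℤ} (hb : ∀ x, 1 ≤ a x + p x ∧ a x + p x ≤ 4)
    (hq : ∀ x, q (G.rev x) = -q x) (hp : OrbitNull G.cw p)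
    (hpq : OrbitNull G.faceNext (fun x => q x - p x)) :
    IsRep G (fun x => a x + p x) (fun x => v x + q x) where
  ang_mem := hb
  antisymm x := by rw [h.antisymm, hq]; ring
  vertex x := by rw [Finset.sum_add_distrib, h.vertex, hp, add_zero]
  face x := by
    rw [← h.face x, ← add_zero (∑ y ∈ _, (2 - a y + v y)), ← hpq x, ← Finset.sum_add_distrib]
    exact Finset.sum_congr rfl fun y _ => by ring

theorem IsRep.vertex_sub (h : IsRep G a v) (h' : IsRep G a' v') :
    OrbitNull G.cw (fun x => a' x - a x) := fun d => by
  rw [Finset.sum_sub_distrib, h.vertex, h'.vertex, sub_self]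

theorem IsRep.face_sub (h : IsRep G a v) (h' : IsRep G a' v') :
    OrbitNull G.faceNext (fun x => (v' x - v x) - (a' x - a x)) := fun d => by
  have h1 := h.face d
  have h2 := h'.face d
  rw [← h1, ← sub_eq_zero, ← Finset.sum_sub_distrib] at h2
  rw [← h2]
  exact Finset.sum_congr rfl fun y _ => by ring

namespace SPTree

variable {μ : SPTree D} {d e : D}

omit [Fintype D] [DecidableEq D] in
theorem sum_turn_sub (L : List D) (a v a' v' : D → ℤ) :
    (L.map fun x => (v' x - v x) - (a' x - a x)).sum
      = (L.map fun x => 2 - a' x + v' x).sum - (L.map fun x => 2 - a x + v x).sum := by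
  rw [eq_sub_iff_add_eq, ← List.sum_map_add]
  congr 1
  exact List.map_congr_left fun x _ => by ring

/-- Two representations in which a component makes the same turn differ in the component by a
change that is itself balanced. -/
theorem Pendant.diff_restrict (h : μ.Pendant G d e) (hav : IsRep G a v) (hav' : IsRep G a' v')
    (hd : a' d = a d) (he : a' e = a e) (ht : μ.rightTurn a' v' = μ.rightTurn a v) :
    OrbitNull G.cw (fun x => if x ∈ μ.darts G then a' x - a x else 0) ∧
    OrbitNull G.faceNext
      (fun x => if x ∈ μ.darts G then (v' x - v x) - (a' x - a x) else 0) := by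
  refine ⟨h.vertex_restrict (hav.vertex_sub hav') (by simp [hd]) (by simp [he]),
    h.face_restrict (hav.face_sub hav') ?_ ?_⟩
  · rw [sum_turn_sub]; exact sub_eq_zero.2 ht
  · rw [sum_turn_sub]
    -- With equal pole angles, equal right turns imply equal left turns.
    have h1 := h.placed.turn_add hav
    have h2 := h.placed.turn_add hav'
    simp only [h.source, h.sink, List.map_cons, List.map_nil, List.sum_cons, List.sum_nil] at h1 h2
    simp only [leftTurn] at h1 h2
    linarith

/-- Replacing a component by another representation of it that makes the same turn. -/
theorem Pendant.exchange (h : μ.Pendant G d e) (hav : IsRep G a v) (hav' : IsRep G a' v')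
    (hd : a' d = a d) (he : a' e = a e) (ht : μ.rightTurn a' v' = μ.rightTurn a v) :
    IsRep G (fun x => if x ∈ μ.darts G then a' x else a x)
      (fun x => if x ∈ μ.darts G then v' x else v x) := by
  obtain ⟨h1, h2⟩ := h.diff_restrict hav hav' hd he ht
  have := hav.add (p := fun x => if x ∈ μ.darts G then a' x - a x else 0)
    (q := fun x => if x ∈ μ.darts G then v' x - v x else 0) ?_ ?_ h1 ?_
  · convert this using 2 with x x
    · split_ifs <;> ring
    · split_ifs <;> ring
  · intro x
    have := hav.ang_mem x
    have := hav'.ang_mem x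
    split_ifs <;> constructor <;> linarith
  · intro x
    simp only [rev_mem_darts_iff, hav.antisymm, hav'.antisymm]
    split_ifs <;> ring
  · convert h2 using 2 with x
    split_ifs <;> ring

end SPTree

/-! ### Bending all edges at a vertex -/

/-- One right bend on every dart that leaves the vertex `U`. -/
def star (G : PlaneGraph D) (U : List D) (x : D) : ℤ :=
  (if x ∈ U then 1 else 0) - (if G.rev x ∈ U then 1 else 0)

omit [Fintype D] in
theorem star_rev (U : List D) (x : D) : star G U (G.rev x) = -star G U x := by
  simp [star, G.rev_rev]

/-- Bending all edges at a vertex amounts to rotating it by a right angle. The head of `x` is the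
origin of `faceNext x`, so `star` is the coboundary of the indicator of `U`. -/
theorem orbitNull_star {U : List D} (hU : IsCyc G.cw U) : OrbitNull G.faceNext (star G U) := by
  have := orbitNull_sub_comp (π := G.faceNext) (fun x => if x ∈ U then (1 : ℤ) else 0)
  convert this using 2 with x
  have : G.rev x ∈ U ↔ G.faceNext x ∈ U := by
    constructor
    · exact fun hx => hU.symm_apply_mem hx
    · intro hx
      have := hU.apply_mem hx
      simpa [PlaneGraph.faceNext] using this
  simp only [star, this]

theorem IsRep.add_star (h : IsRep G a v) {U : List D} (hU : IsCyc G.cw U) (k : ℤ) :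
    IsRep G a (fun x => v x + k * star G U x) := by
  have := h.add (p := fun _ => 0) (q := fun x => k * star G U x) (by simpa using h.ang_mem)
    (fun x => by rw [star_rev]; ring) (fun d => by simp)
    (by simpa using (orbitNull_star hU).mul_const k)
  simpa using this

namespace SPTree

variable {μ : SPTree D} {d e : D}

omit [Fintype D] in
theorem Pendant.star_eq (h : μ.Pendant G d e) {U : List D} (hd : d ∈ U)
    (hU : ∀ x ∈ U, x ∈ μ.darts G → x = d) {y : D} (hy : y ∈ μ.edges) :
    star G U y = if y = d then 1 else 0 := by
  have h1 : y ∈ U ↔ y = d :=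
    ⟨fun hyU => hU y hyU (mem_darts_of_mem_edges hy), fun h => h ▸ hd⟩
  have h2 : G.rev y ∉ U := fun hyU => by
    have hm := List.mem_map_of_mem (f := G.rev) hy
    have := hU _ hyU (mem_darts_of_mem_map hm)
    rw [this] at hm
    exact h.placed.disjoint_edges h.mem_edges hm
  simp [star, h1, h2]

-- Among the edges of the component only `d` leaves `U` and none enters it, so the right boundary
-- gains exactly the bends put on `d`.
omit [Fintype D] in
theorem Pendant.rightTurn_add_star (h : μ.Pendant G d e) {U : List D} (hd : d ∈ U)
    (hU : ∀ x ∈ U, x ∈ μ.darts G → x = d) (a v : D → ℤ) (k : ℤ) :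
    μ.rightTurn a (fun x => v x + k * star G U x) = μ.rightTurn a v + k := by
  have : ∀ x ∈ μ.rightBoundary, 2 - a x + (v x + k * star G U x)
      = (2 - a x + v x) + if x = d then k else 0 := by
    intro x hx
    rw [h.star_eq hd hU (μ.rightBoundary_sublist.subset hx)]
    split_ifs <;> ring
  rw [rightTurn, List.map_congr_left this, List.sum_map_add, rightTurn]
  congr 1
  rw [← List.sum_toFinset _ h.placed.nodup_rightBoundary, Finset.sum_ite_eq', if_pos]
  simpa using h.mem_rightBoundary

/-- The number of bends in the component, when no edge has both left and right bends. -/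
def bendCost (v : D → ℤ) (μ : SPTree D) : ℤ := ∑ x ∈ μ.edges.toFinset, |v x|

omit [Fintype D] in
theorem Pendant.bendCost_add_star_le (h : μ.Pendant G d e) {U : List D} (hd : d ∈ U)
    (hU : ∀ x ∈ U, x ∈ μ.darts G → x = d) (v : D → ℤ) (k : ℤ) :
    μ.bendCost (fun x => v x + k * star G U x) ≤ μ.bendCost v + |k| := by
  have : |k| = ∑ x ∈ μ.edges.toFinset, if x = d then |k| else 0 := by
    rw [Finset.sum_ite_eq', if_pos]
    simpa using h.mem_edges
  rw [bendCost, bendCost, this, ← Finset.sum_add_distrib]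
  refine Finset.sum_le_sum fun x hx => ?_
  rw [h.star_eq hd hU (by simpa using hx)]
  split_ifs
  · simpa using abs_add_le (v x) k
  · simp

end SPTree

end Component

/-! ### Circulations in directed graphs -/

section Flow

variable {N A : Type*} [Fintype A] [DecidableEq A]

/-- `z` is a circulation on the directed graph with arcs `A`. -/
def IsCirculation (tail head : A → N) (z : A → ℤ) : Prop :=
  ∀ φ : N → ℤ, ∑ a, z a * (φ (head a) - φ (tail a)) = 0

/-- There is an arc with property `P` from `x`, a node of `W`, to `y`. -/
def ArcRel (tail head : A → N) (P : A → Prop) (W : Finset N) (x y : N) : Prop :=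
  x ∈ W ∧ ∃ a, P a ∧ tail a = x ∧ head a = y

-- The walk is cut at its last departure from `m`; the remainder leaves only other nodes.
omit [Fintype A] [DecidableEq A] in
theorem reach_erase [DecidableEq N] {tail head : A → N} {P : A → Prop} {W : Finset N} (m : N)
    {x n : N} (h : Relation.ReflTransGen (ArcRel tail head P W) x n) :
    Relation.ReflTransGen (ArcRel tail head P (W.erase m)) x n ∨
      (m ∈ W ∧ ∃ a, P a ∧ tail a = m ∧
        Relation.ReflTransGen (ArcRel tail head P (W.erase m)) (head a) n) := by
  induction h using Relation.ReflTransGen.head_induction_on with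
  | refl => exact .inl .refl
  | @head x y hxy _ ih =>
    rcases ih with ih | ih
    · obtain ⟨hx, a, ha, rfl, rfl⟩ := hxy
      by_cases hm : tail a = m
      · exact .inr ⟨hm ▸ hx, a, ha, hm, ih⟩
      · exact .inl (.head ⟨Finset.mem_erase.2 ⟨hm, hx⟩, a, ha, rfl, rfl⟩ ih)
    · exact .inr ih

/-- A node that can be reached can be reached by a flow of value one that uses no arc twice. -/
theorem exists_unit_flow [DecidableEq N] {tail head : A → N} {P : A → Prop} (n : N)
    (W : Finset N) : ∀ m, Relation.ReflTransGen (ArcRel tail head P W) m n →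
      ∃ c : A → ℤ, (∀ a, c a = 0 ∨ (c a = 1 ∧ P a ∧ tail a ∈ W)) ∧
        ∀ φ : N → ℤ, ∑ a, c a * (φ (head a) - φ (tail a)) = φ n - φ m := by
  induction W using Finset.strongInduction with
  | H W ih =>
    intro m h
    by_cases hmn : m = n
    · exact ⟨fun _ => 0, fun _ => .inl rfl, by simp [hmn]⟩
    rcases reach_erase m h with h' | ⟨hm, a, ha, hta, h'⟩
    · rcases h'.cases_head with h' | ⟨y, hy, -⟩
      · exact absurd h' hmn
      · simp [ArcRel] at hy
    · obtain ⟨c, hc, hφ⟩ := ih _ (Finset.erase_ssubset hm) _ h'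
      -- The remaining flow uses no arc that leaves `m`, so the arc `a` can be added with value one.
      have hca : c a = 0 := by
        rcases hc a with h | ⟨-, -, h⟩
        · exact h
        · simp [hta] at h
      refine ⟨fun b => c b + if b = a then 1 else 0, fun b => ?_, fun φ => ?_⟩
      · by_cases hb : b = a
        · subst hb; exact .inr ⟨by simp [hca], ha, hta ▸ hm⟩
        · rcases hc b with h | ⟨h1, h2, h3⟩
          · exact .inl (by simp [h, hb])
          · exact .inr ⟨by simp [h1, hb], h2, Finset.mem_of_mem_erase h3⟩
      · simp only [add_mul, Finset.sum_add_distrib, hφ, ite_mul, one_mul, zero_mul,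
          Finset.sum_ite_eq', Finset.mem_univ, if_true, hta]
        ring

/-- A nonnegative circulation contains a unit circulation through each arc of positive value. -/
theorem exists_unit_circulation_of_nonneg [Finite N] {tail head : A → N} {z : A → ℤ}
    (hz : IsCirculation tail head z) (h0 : ∀ a, 0 ≤ z a) {e : A} (he : 0 < z e) :
    ∃ c : A → ℤ, IsCirculation tail head c ∧ (∀ a, 0 ≤ c a ∧ c a ≤ z a) ∧ c e = 1 := by
  classical
  have := Fintype.ofFinite N
  set P : A → Prop := fun a => 0 < z a ∧ a ≠ e
  -- Otherwise take the indicator of the nodes reachable from the head of `e` as potential: no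
  -- positive arc leaves this set, while `e` enters it, so the circulation has positive net inflow.
  have hreach : Relation.ReflTransGen (ArcRel tail head P Finset.univ) (head e) (tail e) := by
    by_contra hne
    have h1 := hz fun x =>
      if Relation.ReflTransGen (ArcRel tail head P Finset.univ) (head e) x then 1 else 0
    refine absurd h1 (ne_of_gt (Finset.sum_pos' (fun a _ => ?_) ⟨e, Finset.mem_univ _, ?_⟩))
    · rcases (h0 a).eq_or_lt with h | h
      · simp [← h]
      refine mul_nonneg (h0 a) ?_
      by_cases ht : Relation.ReflTransGen (ArcRel tail head P Finset.univ) (head e) (tail a)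
      · have hae : a ≠ e := fun hae => hne (hae ▸ ht)
        have hh := ht.tail ⟨Finset.mem_univ _, a, ⟨h, hae⟩, rfl, rfl⟩
        simp only [ht, hh, if_true]; norm_num
      · simp only [ht, if_false]; split_ifs <;> norm_num
    · simp only [hne, if_false, Relation.ReflTransGen.refl, if_true]
      simpa using he
  obtain ⟨c, hc, hφ⟩ := exists_unit_flow _ _ _ hreach
  have hce : c e = 0 := by
    rcases hc e with h | ⟨-, h, -⟩
    · exact h
    · exact absurd rfl h.2
  refine ⟨fun a => c a + if a = e then 1 else 0, fun φ => ?_, fun a => ?_, by simp [hce]⟩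
  · simp only [add_mul, Finset.sum_add_distrib, hφ, ite_mul, one_mul, zero_mul,
      Finset.sum_ite_eq', Finset.mem_univ, if_true]
    ring
  · by_cases ha : a = e
    · subst ha; simp only [hce, if_true]; omega
    · have := h0 a
      rcases hc a with h | ⟨h1, h2, -⟩
      · simp only [h, ha, if_false]; omega
      · have := h2.1
        simp only [h1, ha, if_false]; omega

/-- A circulation contains a conformal unit circulation through each arc of nonzero value. -/
theorem exists_unit_circulation [Finite N] {tail head : A → N} {z : A → ℤ}
    (hz : IsCirculation tail head z) {e : A} (he : z e < 0) :
    ∃ c : A → ℤ, IsCirculation tail head c ∧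
      (∀ a, (0 ≤ c a ∧ c a ≤ z a) ∨ (z a ≤ c a ∧ c a ≤ 0)) ∧ c e = -1 := by
  have key : ∀ (w : A → ℤ) (φ : N → ℤ) (a : A),
      w a * (φ (if 0 ≤ z a then head a else tail a) - φ (if 0 ≤ z a then tail a else head a))
      = (if 0 ≤ z a then w a else -w a) * (φ (head a) - φ (tail a)) := by
    intro w φ a
    split_ifs <;> ring
  -- Reversing the arcs of negative value reduces to the nonnegative case with values `|z a|`.
  obtain ⟨c, hc, hcz, hce⟩ := exists_unit_circulation_of_nonneg
    (tail := fun a => if 0 ≤ z a then tail a else head a)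
    (head := fun a => if 0 ≤ z a then head a else tail a) (z := fun a => |z a|) (e := e)
    (fun φ => by
      refine Eq.trans ?_ (hz φ)
      refine Finset.sum_congr rfl fun a _ => ?_
      refine (key (fun a => |z a|) φ a).trans ?_
      congr 1
      split_ifs with h
      · exact abs_of_nonneg h
      · rw [abs_of_neg (not_le.1 h), neg_neg]) (fun a => abs_nonneg _) (abs_pos.2 he.ne)
  refine ⟨fun a => if 0 ≤ z a then c a else -c a, fun φ => ?_, fun a => ?_, ?_⟩
  · refine Eq.trans ?_ (hc φ)
    exact Finset.sum_congr rfl fun a _ => (key c φ a).symm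
  · have h1 := hcz a
    by_cases h : 0 ≤ z a
    · rw [abs_of_nonneg h] at h1
      simpa [h] using Or.inl h1
    · rw [abs_of_neg (not_le.1 h)] at h1
      right
      simp only [h, if_false]
      omega
  · simp [not_le.2 he, hce]

end Flow

/-! ### Discrete convexity of the bend count of one component. -/

section Convexity

variable {D : Type*} [Fintype D] [DecidableEq D] {G : PlaneGraph D}

/-- A component whose poles have degree one in it, with the vertex `U` as a pole, such that the
turn of the component is determined by the representation of the other components. -/
structure SPTree.Branch (G : PlaneGraph D) (μ : SPTree D) (d e : D) (U : List D) : Prop where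
  pendant : μ.Pendant G d e
  isCyc : IsCyc G.cw U
  mem : d ∈ U
  eq_of_mem : ∀ x ∈ U, x ∈ μ.darts G → x = d
  angle_eq : ∀ a v, IsRep G a v → a d = 1 ∧ a e = 1
  local_turn : ∀ a v a' v', IsRep G a v → IsRep G a' v' →
    (∀ x, x ∉ μ.darts G → a' x = a x ∧ v' x = v x) → μ.rightTurn a' v' = μ.rightTurn a v

-- Summation by parts along the involution `rev`.
omit [DecidableEq D] in
theorem sum_mul_sub_rev (w ψ : D → ℤ) :
    ∑ x, w x * (ψ x - ψ (G.rev x)) = ∑ x, ψ x * (w x - w (G.rev x)) := by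
  have : ∑ x, w x * ψ (G.rev x) = ∑ x, w (G.rev x) * ψ x := by
    refine Fintype.sum_equiv G.rev _ _ fun x => ?_
    rw [G.rev_rev]
  simp only [mul_sub, Finset.sum_sub_distrib, this]
  congr 1 <;> exact Finset.sum_congr rfl fun x _ => mul_comm _ _

/-- Convexity of the absolute value: `s + c` and `t - c` lie between `s` and `t` and have the same
sum. -/
theorem abs_exchange {s t c : ℤ} (h : (0 ≤ c ∧ c ≤ t - s) ∨ (t - s ≤ c ∧ c ≤ 0)) :
    |s + c| + |t - c| ≤ |s| + |t| := by
  simp only [abs_eq_max_neg]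
  omega

namespace SPTree

variable {μ : SPTree D} {d e : D} {U : List D} {a v a' v' : D → ℤ}

omit [Fintype D] [DecidableEq D] in
theorem mem_darts_iff {x : D} : x ∈ μ.darts G ↔ x ∈ μ.edges ∨ G.rev x ∈ μ.edges := by
  rw [darts, List.mem_append, List.mem_map]
  refine or_congr Iff.rfl ⟨?_, fun h => ⟨_, h, G.rev_rev x⟩⟩
  rintro ⟨y, hy, rfl⟩
  rwa [G.rev_rev]

omit [Fintype D] [DecidableEq D] in
theorem Placed.rev_notMem_edges (h : μ.Placed G) {x : D} (hx : x ∈ μ.edges) :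
    G.rev x ∉ μ.edges :=
  fun h' => h.disjoint_edges h' (List.mem_map_of_mem hx)

/-- The tails of the arcs of the flow network of the component; the first arc is an additional
copy of the bends on the dart `d`, the next ones are the angles, the last ones are the bends. -/
def arcTail (G : PlaneGraph D) (d : D) : Option (D ⊕ D) →
    Quotient (Equiv.Perm.SameCycle.setoid G.cw) ⊕ Quotient (Equiv.Perm.SameCycle.setoid G.faceNext)
  | none => .inr (Quotient.mk _ (G.rev d))
  | some (.inl x) => .inr (Quotient.mk _ x)
  | some (.inr x) => .inr (Quotient.mk _ (G.rev x))

/-- The heads of the arcs of the flow network of the component. -/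
def arcHead (G : PlaneGraph D) (d : D) : Option (D ⊕ D) →
    Quotient (Equiv.Perm.SameCycle.setoid G.cw) ⊕ Quotient (Equiv.Perm.SameCycle.setoid G.faceNext)
  | none => .inr (Quotient.mk _ d)
  | some (.inl x) => .inl (Quotient.mk _ x)
  | some (.inr x) => .inr (Quotient.mk _ x)

/-- Net inflow at the nodes: a vertex receives its angles; a face receives the net bends, those of
the extra arc included, minus its angles. So circulations are exactly the changes that preserve the
vertex and face conditions. -/
theorem sum_arcs (d : D) (c : Option (D ⊕ D) → ℤ)
    (φ : Quotient (Equiv.Perm.SameCycle.setoid G.cw) ⊕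
      Quotient (Equiv.Perm.SameCycle.setoid G.faceNext) → ℤ) :
    ∑ a, c a * (φ (arcHead G d a) - φ (arcTail G d a))
      = ∑ x, φ (.inl (Quotient.mk _ x)) * c (some (.inl x))
        + ∑ x, φ (.inr (Quotient.mk _ x)) *
          ((c (some (.inr x)) + if x = d then c none else 0)
            - (c (some (.inr (G.rev x))) + if G.rev x = d then c none else 0)
            - c (some (.inl x))) := by
  have h1 := sum_mul_sub_rev (G := G) (fun x => c (some (.inr x)) + if x = d then c none else 0)
    (fun x => φ (.inr (Quotient.mk _ x)))
  simp only [mul_sub (φ _) _ (c _), Finset.sum_sub_distrib]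
  rw [← h1]
  simp only [Fintype.sum_option, Fintype.sum_sum_type, arcHead, arcTail, add_mul, ite_mul,
    zero_mul, Finset.sum_add_distrib, Finset.sum_ite_eq', Finset.mem_univ, if_true]
  have h2 : ∑ x, c (some (.inl x)) * (φ (.inl (Quotient.mk _ x)) - φ (.inr (Quotient.mk _ x)))
      = ∑ x, φ (.inl (Quotient.mk _ x)) * c (some (.inl x))
        - ∑ x, φ (.inr (Quotient.mk _ x)) * c (some (.inl x)) := by
    rw [← Finset.sum_sub_distrib]
    exact Finset.sum_congr rfl fun x _ => by ring
  rw [h2]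
  ring

/-- The network of a branch carries the difference of two representations of the branch. -/
theorem Branch.isCirculation (h : μ.Branch G d e U) (hav : IsRep G a v) (hav' : IsRep G a' v')
    {k : ℤ} (ht : μ.rightTurn a' v' = μ.rightTurn a v + k) :
    IsCirculation (arcTail G d) (arcHead G d) (fun
      | none => -k
      | some (.inl x) => if x ∈ μ.darts G then a' x - a x else 0
      | some (.inr x) => if x ∈ μ.edges then v' x - v x else 0) := by
  -- Rotating the pole back by `k` equalises the turns, so the difference restricted to the
  -- component is balanced. Inside the component this rotation only bends `d`, which the extra arc
  -- records.
  have hav'' := hav'.add_star h.isCyc (-k)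
  have ht' := h.pendant.rightTurn_add_star h.mem h.eq_of_mem a' v' (-k)
  obtain ⟨hd, he⟩ := h.angle_eq a v hav
  obtain ⟨hd', he'⟩ := h.angle_eq a' v' hav'
  obtain ⟨h1, h2⟩ := h.pendant.diff_restrict hav hav'' (hd'.trans hd.symm) (he'.trans he.symm)
    (by rw [ht', ht]; ring)
  intro φ
  rw [sum_arcs]
  have e1 := h1.sum_mul fun q => φ (.inl q)
  have e2 := h2.sum_mul fun q => φ (.inr q)
  rw [← add_zero (0 : ℤ)]
  refine congrArg₂ _ e1 (Eq.trans (Finset.sum_congr rfl fun x _ => ?_) e2)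
  congr 1
  by_cases hx : x ∈ μ.edges
  · have hx' := h.pendant.placed.rev_notMem_edges hx
    have hx'' : G.rev x ≠ d := fun hh => hx' (hh ▸ h.pendant.mem_edges)
    simp only [hx, hx', hx'', mem_darts_of_mem_edges hx, if_true, if_false,
      h.pendant.star_eq h.mem h.eq_of_mem hx]
    split_ifs <;> ring
  · have hxd : x ≠ d := fun hh => hx (hh ▸ h.pendant.mem_edges)
    by_cases hx' : G.rev x ∈ μ.edges
    · have hs : star G U x = -if G.rev x = d then 1 else 0 := by
        rw [← h.pendant.star_eq h.mem h.eq_of_mem hx', star_rev, neg_neg]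
      simp only [hx, hx', hxd, mem_darts_iff (G := G) (μ := μ) (x := x), or_true, if_true,
        if_false, hav.antisymm, hav'.antisymm, hs]
      split_ifs <;> ring
    · have hx'' : G.rev x ≠ d := fun hh => hx' (hh ▸ h.pendant.mem_edges)
      simp only [hx, hx', hxd, hx'', mem_darts_iff (G := G) (μ := μ) (x := x), or_self, if_false]
      ring

/-- Discrete convexity of the number of bends of a branch as a function of its turn. -/
theorem Branch.convex (h : μ.Branch G d e U) (hav : IsRep G a v) (hav' : IsRep G a' v')
    (ht : μ.rightTurn a v < μ.rightTurn a' v') :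
    ∃ b w b' w', IsRep G b w ∧ IsRep G b' w' ∧ μ.rightTurn b w = μ.rightTurn a v + 1 ∧
      μ.rightTurn b' w' = μ.rightTurn a' v' - 1 ∧
      μ.bendCost w + μ.bendCost w' ≤ μ.bendCost v + μ.bendCost v' := by
  obtain ⟨k, hk⟩ : ∃ k, μ.rightTurn a' v' = μ.rightTurn a v + k :=
    ⟨μ.rightTurn a' v' - μ.rightTurn a v, by ring⟩
  -- The extra arc carries `-k < 0`; the unit circulation through it has value `-1` there.
  obtain ⟨c, hc, hcz, hcn⟩ := exists_unit_circulation (h.isCirculation hav hav' hk) (e := none)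
    (show -k < 0 by linarith)
  set p : D → ℤ := fun x => c (some (.inl x)) with hp
  set r : D → ℤ := fun x => c (some (.inr x)) + if x = d then c none else 0 with hr
  set q : D → ℤ := fun x => r x - r (G.rev x) with hq
  have hq' : ∀ x, q (G.rev x) = -q x := fun x => by simp only [hq, G.rev_rev]; ring
  have hpnull : OrbitNull G.cw p := orbitNull_of_sum_mul fun φ => by
    have := hc (Sum.elim φ fun _ => 0)
    rw [sum_arcs] at this
    simpa using this
  have hqnull : OrbitNull G.faceNext (fun x => q x - p x) := orbitNull_of_sum_mul fun φ => by
    have := hc (Sum.elim (fun _ => 0) φ)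
    rw [sum_arcs] at this
    simpa using this
  have hpz : ∀ x, (0 ≤ p x ∧ p x ≤ a' x - a x) ∨ (a' x - a x ≤ p x ∧ p x ≤ 0) := fun x => by
    have := hcz (some (.inl x))
    dsimp only at this
    split_ifs at this with hx
    · exact this
    · simp only [hp]; omega
  have hp0 : ∀ x, x ∉ μ.darts G → p x = 0 := fun x hx => by
    have := hcz (some (.inl x))
    dsimp only at this
    rw [if_neg hx] at this
    simp only [hp]; omega
  have hr0 : ∀ x, x ∉ μ.edges → r x = 0 := fun x hx => by
    have := hcz (some (.inr x))
    dsimp only at this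
    rw [if_neg hx] at this
    have hxd : x ≠ d := fun hh => hx (hh ▸ h.pendant.mem_edges)
    simp only [hr, hxd, if_false]; omega
  have hq0 : ∀ x, x ∉ μ.darts G → q x = 0 := fun x hx => by
    rw [mem_darts_iff, not_or] at hx
    simp only [hq, hr0 x hx.1, hr0 _ hx.2, sub_zero]
  have hqe : ∀ x ∈ μ.edges, q x + star G U x = c (some (.inr x)) := fun x hx => by
    have h0 : q x = r x := by
      simp only [hq, hr0 _ (h.pendant.placed.rev_notMem_edges hx), sub_zero]
    simp only [h0, h.pendant.star_eq h.mem h.eq_of_mem hx, hr, hcn]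
    split_ifs <;> ring
  -- By conformality the new angles lie between `a x` and `a' x`, hence in the admissible range.
  have B1 := hav.add (p := p) (q := q) (fun x => by
    have := hpz x; have := hav.ang_mem x; have := hav'.ang_mem x; omega) hq' hpnull hqnull
  have B2 := hav'.add (p := fun x => -1 * p x) (q := fun x => -1 * q x) (fun x => by
    have := hpz x; have := hav.ang_mem x; have := hav'.ang_mem x; omega)
    (fun x => by rw [hq']; ring) (hpnull.mul_const _) (by
      convert hqnull.mul_const (-1) using 2 with x; ring)
  -- The change is confined to the component, whose turn is dictated by the outside.
  have t1 := h.local_turn _ _ _ _ hav B1 fun x hx => by simp [hp0 x hx, hq0 x hx]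
  have t2 := h.local_turn _ _ _ _ hav' B2 fun x hx => by simp [hp0 x hx, hq0 x hx]
  -- A quarter rotation of the pole moves the turn by one and cancels the bend of the extra arc on
  -- `d`, so on the component's edges only the conformal part of `c` remains.
  refine ⟨_, _, _, _, B1.add_star h.isCyc 1, B2.add_star h.isCyc (-1), ?_, ?_, ?_⟩
  · rw [h.pendant.rightTurn_add_star h.mem h.eq_of_mem, t1]
  · rw [h.pendant.rightTurn_add_star h.mem h.eq_of_mem, t2]; ring
  · simp only [bendCost, ← Finset.sum_add_distrib]
    refine Finset.sum_le_sum fun x hx => ?_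
    have hx' := List.mem_toFinset.1 hx
    have e1 : v x + q x + 1 * star G U x = v x + c (some (.inr x)) := by rw [← hqe x hx']; ring
    have e2 : v' x + -1 * q x + -1 * star G U x = v' x - c (some (.inr x)) := by
      rw [← hqe x hx']; ring
    rw [e1, e2]
    refine abs_exchange ?_
    have := hcz (some (.inr x))
    simpa only [hx', if_true] using this

omit [Fintype D] in
theorem bendCost_nonneg (v : D → ℤ) (μ : SPTree D) : 0 ≤ μ.bendCost v :=
  Finset.sum_nonneg fun _ _ => abs_nonneg _

/-- The number of bends of a branch is at least the excess of its turn over the largest turn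
without bends. -/
theorem Branch.le_add_bendCost (h : μ.Branch G d e U) {m : ℤ}
    (hm : ∃ a v, IsRep G a v ∧ μ.bendCost v = 0 ∧ μ.rightTurn a v = m)
    (hmax : ∀ a v, IsRep G a v → μ.bendCost v = 0 → μ.rightTurn a v ≤ m) :
    ∀ (n : ℕ) (a v : D → ℤ), IsRep G a v → μ.rightTurn a v ≤ m + n →
      μ.rightTurn a v ≤ m + μ.bendCost v := by
  obtain ⟨a₀, v₀, h₀, hc₀, ht₀⟩ := hm
  intro n
  induction n with
  | zero => intro a v _ ht; have := bendCost_nonneg v μ; push_cast at ht; linarith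
  | succ n ih =>
    intro a v hav ht
    by_cases hlt : μ.rightTurn a₀ v₀ < μ.rightTurn a v
    -- The pair moves to the turns `m + 1` and one less than the given turn. The first costs at
    -- least one bend since `m` is the largest free turn, so the cost drops by at least one per
    -- step.
    · obtain ⟨b, w, b', w', hb, hb', hbt, hbt', hcost⟩ := h.convex h₀ hav hlt
      have h1 := ih b' w' hb' (by push_cast at ht; linarith)
      have h2 : μ.bendCost w ≠ 0 := fun h0 => by have := hmax b w hb h0; linarith
      have h3 := bendCost_nonneg w μ
      omega
    · have := bendCost_nonneg v μ; linarith

/-- The number of bends of a branch is at least the distance of its turn below the least turn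
without bends. -/
theorem Branch.sub_bendCost_le (h : μ.Branch G d e U) {m : ℤ}
    (hm : ∃ a v, IsRep G a v ∧ μ.bendCost v = 0 ∧ μ.rightTurn a v = m)
    (hmin : ∀ a v, IsRep G a v → μ.bendCost v = 0 → m ≤ μ.rightTurn a v) :
    ∀ (n : ℕ) (a v : D → ℤ), IsRep G a v → m - n ≤ μ.rightTurn a v →
      m - μ.bendCost v ≤ μ.rightTurn a v := by
  obtain ⟨a₀, v₀, h₀, hc₀, ht₀⟩ := hm
  intro n
  induction n with
  | zero => intro a v _ ht; have := bendCost_nonneg v μ; push_cast at ht; linarith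
  | succ n ih =>
    intro a v hav ht
    by_cases hlt : μ.rightTurn a v < μ.rightTurn a₀ v₀
    · obtain ⟨b', w', b, w, hb', hb, hbt', hbt, hcost⟩ := h.convex hav h₀ hlt
      have h1 := ih b' w' hb' (by push_cast at ht; linarith)
      have h2 : μ.bendCost w ≠ 0 := fun h0 => by have := hmin b w hb h0; linarith
      have h3 := bendCost_nonneg w μ
      omega
    · have := bendCost_nonneg v μ; linarith

/-- The turns of a branch without bends form an interval. -/
theorem Branch.exists_of_mem_interval (h : μ.Branch G d e U) {m M : ℤ}
    (hm : ∃ a v, IsRep G a v ∧ μ.bendCost v = 0 ∧ μ.rightTurn a v = m)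
    (hM : ∃ a v, IsRep G a v ∧ μ.bendCost v = 0 ∧ μ.rightTurn a v = M) (n : ℕ)
    (hn : m + n ≤ M) :
    ∃ a v, IsRep G a v ∧ μ.bendCost v = 0 ∧ μ.rightTurn a v = m + n := by
  obtain ⟨a₀, v₀, h₀, hc₀, ht₀⟩ := hM
  induction n with
  | zero => simpa using hm
  | succ n ih =>
    push_cast at hn ⊢
    obtain ⟨a, v, hav, hc, ht⟩ := ih (by linarith)
    -- Both representations are free of bends, so the total cost zero is inherited by the new pair.
    obtain ⟨b, w, b', w', hb, -, hbt, -, hcost⟩ := h.convex hav h₀ (by linarith)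
    refine ⟨b, w, hb, ?_, by linarith⟩
    have h1 := bendCost_nonneg w μ
    have h2 := bendCost_nonneg w' μ
    linarith

end SPTree

end Convexity

/-! ### P-nodes with three children. -/

section Par3

variable {D : Type*} [Fintype D] [DecidableEq D] {G : PlaneGraph D}

theorem PlaneGraph.IsFourGraph.length_le (h : G.IsFourGraph) {L : List D} (hL : IsCyc G.cw L)
    (hne : L ≠ []) : L.length ≤ 4 := by
  obtain ⟨d, hd⟩ := List.exists_mem_of_ne_nil L hne
  have := h d
  have hs : {d' | G.cw.SameCycle d d'} = (L.toFinset : Set D) := by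
    ext x; simp [hL.sameCycle_iff hd]
  rwa [hs, Set.ncard_coe_finset, List.toFinset_card_of_nodup hL.nodup] at this

/-- Four angles of at least 90 degrees have sum 360 degrees. -/
theorem IsRep.eq_one {a v : D → ℤ} (h : IsRep G a v) {p q r s : D} (hL : IsCyc G.cw [p, q, r, s]) :
    a p = 1 ∧ a q = 1 ∧ a r = 1 ∧ a s = 1 := by
  have h1 := h.sum_vertex hL (by simp)
  simp only [List.map_cons, List.map_nil, List.sum_cons, List.sum_nil] at h1
  have := h.ang_mem p
  have := h.ang_mem q
  have := h.ang_mem r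
  have := h.ang_mem s
  omega

namespace SPTree

omit [Fintype D] [DecidableEq D] in
theorem rightTurn_congr {μ : SPTree D} {a v a' v' : D → ℤ}
    (h : ∀ x ∈ μ.edges, a' x = a x ∧ v' x = v x) : μ.rightTurn a' v' = μ.rightTurn a v := by
  rw [rightTurn, rightTurn]
  congr 1
  refine List.map_congr_left fun x hx => ?_
  obtain ⟨h1, h2⟩ := h x (μ.rightBoundary_sublist.subset hx)
  rw [h1, h2]

omit [Fintype D] in
theorem bendCost_congr {μ : SPTree D} {v v' : D → ℤ} (h : ∀ x ∈ μ.edges, v' x = v x) :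
    μ.bendCost v' = μ.bendCost v :=
  Finset.sum_congr rfl fun x hx => by rw [h x (List.mem_toFinset.1 hx)]

/-- The three components of a P-node with three children, in a graph of maximum degree four: each
pole has exactly one dart outside the node. -/
structure Triple (G : PlaneGraph D) (l c r : SPTree D) (dl dc dr du el ec er eu : D) :
    Prop where
  left : l.Pendant G dl el
  center : c.Pendant G dc ec
  right : r.Pendant G dr er
  source : IsCyc G.cw [dl, dc, dr, du]
  sink : IsCyc G.cw [er, ec, el, eu]
  outside : du ∉ (par3 l c r).darts G
  adjacent_left : Adjacent G l c
  adjacent_right : Adjacent G c r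
  disjoint : (l.darts G).Disjoint (r.darts G)

theorem Placed.exists_triple {l c r : SPTree D} (h : (par3 l c r).Placed G)
    (hdeg : G.IsFourGraph) : ∃ dl dc dr du el ec er eu, Triple G l c r dl dc dr du el ec er eu := by
  obtain ⟨C, hC, hC', hC''⟩ := h.source
  obtain ⟨E, hE, hE', -⟩ := h.sink
  -- At each pole, four nonempty groups of darts (three children and the outside) share at most four
  -- darts, so each group is a single dart.
  have h1 := hdeg.length_le hC' (by simp [hC])
  have h2 := hdeg.length_le hE' (by simp [hE])
  simp only [sourceDarts, sinkDarts, List.length_append, List.length_reverse] at h1 h2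
  have l1 := List.length_pos_iff.2 l.sourceDarts_ne_nil
  have l2 := List.length_pos_iff.2 c.sourceDarts_ne_nil
  have l3 := List.length_pos_iff.2 r.sourceDarts_ne_nil
  have l4 := List.length_pos_iff.2 hC
  have l5 := List.length_pos_iff.2 (l.sinkDarts_ne_nil (G := G))
  have l6 := List.length_pos_iff.2 (c.sinkDarts_ne_nil (G := G))
  have l7 := List.length_pos_iff.2 (r.sinkDarts_ne_nil (G := G))
  have l8 := List.length_pos_iff.2 hE
  obtain ⟨dl, hdl⟩ := List.length_eq_one_iff.1 (show l.sourceDarts.length = 1 by omega)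
  obtain ⟨dc, hdc⟩ := List.length_eq_one_iff.1 (show c.sourceDarts.length = 1 by omega)
  obtain ⟨dr, hdr⟩ := List.length_eq_one_iff.1 (show r.sourceDarts.length = 1 by omega)
  obtain ⟨du, rfl⟩ := List.length_eq_one_iff.1 (show C.length = 1 by omega)
  obtain ⟨el, hel⟩ := List.length_eq_one_iff.1 (show (l.sinkDarts G).length = 1 by omega)
  obtain ⟨ec, hec⟩ := List.length_eq_one_iff.1 (show (c.sinkDarts G).length = 1 by omega)
  obtain ⟨er, her⟩ := List.length_eq_one_iff.1 (show (r.sinkDarts G).length = 1 by omega)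
  obtain ⟨eu, rfl⟩ := List.length_eq_one_iff.1 (show E.length = 1 by omega)
  have hn := (darts_par3_perm (G := G) l c r).nodup_iff.1 h.nodup
  have hd := (List.nodup_append'.1 hn).2.2
  rw [List.disjoint_append_right] at hd
  refine ⟨dl, dc, dr, du, el, ec, er, eu, ⟨h.of_par3.1, hdl, hel⟩, ⟨h.of_par3.2.1, hdc, hec⟩,
    ⟨h.of_par3.2.2, hdr, her⟩, ?_, ?_, hC'' _ (by simp), h.adjacent_par3_left,
    h.adjacent_par3_right, hd.2⟩
  · simpa [sourceDarts, hdl, hdc, hdr] using hC'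
  · simpa [sinkDarts, hel, hec, her] using hE'

variable {l c r : SPTree D} {dl dc dr du el ec er eu : D}

/-- The 2 is the sum of the two right angles of `c` at the poles. -/
theorem Triple.turn_left (h : Triple G l c r dl dc dr du el ec er eu) {a v : D → ℤ}
    (hav : IsRep G a v) : l.rightTurn a v = c.rightTurn a v + 2 := by
  have h1 := h.adjacent_left.rightTurn_eq hav
  simp only [h.center.source, h.center.sink, List.map_cons, List.map_nil, List.sum_cons,
    List.sum_nil] at h1
  have := hav.eq_one h.source
  have := hav.eq_one h.sink
  omega

theorem Triple.turn_right (h : Triple G l c r dl dc dr du el ec er eu) {a v : D → ℤ}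
    (hav : IsRep G a v) : c.rightTurn a v = r.rightTurn a v + 2 := by
  have h1 := h.adjacent_right.rightTurn_eq hav
  simp only [h.right.source, h.right.sink, List.map_cons, List.map_nil, List.sum_cons,
    List.sum_nil] at h1
  have := hav.eq_one h.source
  have := hav.eq_one h.sink
  omega

omit [Fintype D] [DecidableEq D] in
theorem Triple.notMem (h : Triple G l c r dl dc dr du el ec er eu) :
    du ∉ l.darts G ∧ du ∉ c.darts G ∧ du ∉ r.darts G := by
  have := h.outside
  rw [(darts_par3_perm (G := G) l c r).mem_iff] at this
  simpa using this

theorem Triple.branch_left (h : Triple G l c r dl dc dr du el ec er eu) :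
    l.Branch G dl el [dl, dc, dr, du] where
  pendant := h.left
  isCyc := h.source
  mem := by simp
  eq_of_mem x hx hxl := by
    simp only [List.mem_cons, List.not_mem_nil, or_false] at hx
    rcases hx with rfl | rfl | rfl | rfl
    · rfl
    · exact (h.adjacent_left.disjoint hxl (mem_darts_of_mem_edges h.center.mem_edges)).elim
    · exact (h.disjoint hxl (mem_darts_of_mem_edges h.right.mem_edges)).elim
    · exact absurd hxl h.notMem.1
  angle_eq a v hav := ⟨(hav.eq_one h.source).1, (hav.eq_one h.sink).2.2.1⟩
  -- The turn of the neighbour across the common face, which lies outside the component, determines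
  -- the turn.
  local_turn a v a' v' hav hav' hx := by
    rw [h.turn_left hav, h.turn_left hav', rightTurn_congr fun x hxc =>
      hx x fun hxl => h.adjacent_left.disjoint hxl (mem_darts_of_mem_edges hxc)]

theorem Triple.branch_center (h : Triple G l c r dl dc dr du el ec er eu) :
    c.Branch G dc ec [dl, dc, dr, du] where
  pendant := h.center
  isCyc := h.source
  mem := by simp
  eq_of_mem x hx hxc := by
    simp only [List.mem_cons, List.not_mem_nil, or_false] at hx
    rcases hx with rfl | rfl | rfl | rfl
    · exact (h.adjacent_left.disjoint (mem_darts_of_mem_edges h.left.mem_edges) hxc).elim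
    · rfl
    · exact (h.adjacent_right.disjoint hxc (mem_darts_of_mem_edges h.right.mem_edges)).elim
    · exact absurd hxc h.notMem.2.1
  angle_eq a v hav := ⟨(hav.eq_one h.source).2.1, (hav.eq_one h.sink).2.1⟩
  local_turn a v a' v' hav hav' hx := by
    rw [h.turn_right hav, h.turn_right hav', rightTurn_congr fun x hxr =>
      hx x fun hxc => h.adjacent_right.disjoint hxc (mem_darts_of_mem_edges hxr)]

theorem Triple.branch_right (h : Triple G l c r dl dc dr du el ec er eu) :
    r.Branch G dr er [dl, dc, dr, du] where
  pendant := h.right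
  isCyc := h.source
  mem := by simp
  eq_of_mem x hx hxr := by
    simp only [List.mem_cons, List.not_mem_nil, or_false] at hx
    rcases hx with rfl | rfl | rfl | rfl
    · exact (h.disjoint (mem_darts_of_mem_edges h.left.mem_edges) hxr).elim
    · exact (h.adjacent_right.disjoint (mem_darts_of_mem_edges h.center.mem_edges) hxr).elim
    · rfl
    · exact absurd hxr h.notMem.2.2
  angle_eq a v hav := ⟨(hav.eq_one h.source).2.2.1, (hav.eq_one h.sink).1⟩
  local_turn a v a' v' hav hav' hx := by
    have h1 := h.turn_right hav
    have h2 := h.turn_right hav'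
    rw [rightTurn_congr fun x hxc => hx x fun hxr =>
      h.adjacent_right.disjoint (mem_darts_of_mem_edges hxc) hxr] at h2
    linarith

omit [Fintype D] in
theorem Triple.bendCost (h : Triple G l c r dl dc dr du el ec er eu) (v : D → ℤ) :
    (par3 l c r).bendCost v = l.bendCost v + c.bendCost v + r.bendCost v := by
  have h1 : Disjoint l.edges.toFinset c.edges.toFinset := by
    rw [List.disjoint_toFinset_iff_disjoint]
    exact fun x hx hx' => h.adjacent_left.disjoint (mem_darts_of_mem_edges hx)
      (mem_darts_of_mem_edges hx')
  have h2 : Disjoint (l.edges.toFinset ∪ c.edges.toFinset) r.edges.toFinset := by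
    rw [Finset.disjoint_union_left, List.disjoint_toFinset_iff_disjoint,
      List.disjoint_toFinset_iff_disjoint]
    exact ⟨fun x hx hx' => h.disjoint (mem_darts_of_mem_edges hx) (mem_darts_of_mem_edges hx'),
      fun x hx hx' => h.adjacent_right.disjoint (mem_darts_of_mem_edges hx)
      (mem_darts_of_mem_edges hx')⟩
  rw [SPTree.bendCost, edges, List.toFinset_append, List.toFinset_append, Finset.sum_union h2,
    Finset.sum_union h1]
  rfl

/-- Representations of the three components with matching turns can be combined. -/
theorem Triple.combine (h : Triple G l c r dl dc dr du el ec er eu)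
    {al vl ac vc ar vr : D → ℤ} (hl : IsRep G al vl) (hc : IsRep G ac vc) (hr : IsRep G ar vr)
    (hlc : l.rightTurn al vl = c.rightTurn ac vc + 2)
    (hcr : c.rightTurn ac vc = r.rightTurn ar vr + 2) :
    ∃ a v, IsRep G a v ∧ c.rightTurn a v = c.rightTurn ac vc ∧
      (par3 l c r).bendCost v = l.bendCost vl + c.bendCost vc + r.bendCost vr := by
  have t1 := h.turn_left hl
  obtain ⟨p1, p2⟩ := h.branch_center.angle_eq _ _ hl
  obtain ⟨q1, q2⟩ := h.branch_center.angle_eq _ _ hc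
  -- The representation given for `l` serves as base. Its centre component already has the turn
  -- required by `hlc`, so the centre can be exchanged; then the right component likewise.
  have e1 := h.center.exchange hl hc (q1.trans p1.symm) (q2.trans p2.symm) (by linarith)
  have hL : ∀ x ∈ l.edges, x ∉ c.darts G := fun x hx hx' =>
    h.adjacent_left.disjoint (mem_darts_of_mem_edges hx) hx'
  have hL' : ∀ x ∈ l.edges, x ∉ r.darts G := fun x hx hx' =>
    h.disjoint (mem_darts_of_mem_edges hx) hx'
  have hC : ∀ x ∈ c.edges, x ∉ r.darts G := fun x hx hx' =>
    h.adjacent_right.disjoint (mem_darts_of_mem_edges hx) hx'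
  have t2 := h.turn_right e1
  have t3 := h.turn_left e1
  rw [rightTurn_congr (a := al) (v := vl) fun x hx => by simp [hL x hx]] at t3
  obtain ⟨p1, p2⟩ := h.branch_right.angle_eq _ _ e1
  obtain ⟨q1, q2⟩ := h.branch_right.angle_eq _ _ hr
  have e2 := h.right.exchange e1 hr (q1.trans p1.symm) (q2.trans p2.symm) (by linarith)
  refine ⟨_, _, e2, ?_, ?_⟩
  · refine rightTurn_congr fun x hx => ?_
    simp [hC x hx, mem_darts_of_mem_edges hx]
  · rw [h.bendCost]
    congr 1
    · congr 1
      · exact bendCost_congr fun x hx => by simp [hL x hx, hL' x hx]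
      · exact bendCost_congr fun x hx => by simp [hC x hx, mem_darts_of_mem_edges hx]
    · exact bendCost_congr fun x hx => by simp [mem_darts_of_mem_edges hx]

end SPTree

/-! ### Spirality -/

/-- Both poles are their own alias vertices, so spines are plain paths. The subtracted 1 is the
contribution `2 - 1` of the right angle at the source to `rightTurn`. -/
theorem OrthRep.hasSpirality_pendant (H : OrthRep G) {μ : SPTree D} {d e : D}
    (h : μ.Pendant G d e) (hd : H.angle d = 1) (σ : ℚ) :
    H.HasSpirality μ σ ↔ σ = ((μ.rightTurn H.angle H.netBend - 1 : ℤ) : ℚ) := by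
  have key : ∀ P, μ.IsPath P →
      ((H.leftSpineTurn μ P : ℚ) + (H.rightSpineTurn μ P : ℚ)) / 2
        = ((μ.rightTurn H.angle H.netBend - 1 : ℤ) : ℚ) := by
    intro P hP
    obtain ⟨f, g, A, B, A', B', -, -, hs, ht, hturn⟩ := hP.pathTurn_eq h.placed H
    rw [h.source, List.singleton_eq_append_iff] at hs
    rw [h.sink, List.singleton_eq_append_iff] at ht
    simp only [List.cons_ne_nil, and_false, or_false, List.cons.injEq] at hs ht
    obtain ⟨-, rfl, rfl⟩ := hs
    obtain ⟨-, -, rfl⟩ := ht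
    have : H.pathTurn P = μ.rightTurn H.angle H.netBend - 1 := by
      rw [hturn]; simp [hd]; ring
    simp only [OrthRep.leftSpineTurn, OrthRep.rightSpineTurn, OrthRep.sourceTurn,
      OrthRep.sinkTurn, h.source, h.sink, List.length_singleton, if_true, this]
    push_cast
    ring
  constructor
  · intro hσ
    obtain ⟨P, hP⟩ := μ.exists_isPath
    rw [hσ P hP, key P hP]
  · rintro rfl P hP
    exact (key P hP).symm

/-- With one outside dart per pole the leftmost and rightmost spines coincide. The source corner is
already in `rightTurn`; the turn `2 - H.angle y` at the sink is added. -/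
theorem OrthRep.hasSpirality_of_single_outside (H : OrthRep G) {ν : SPTree D} (h : ν.Placed G)
    {x y : D} (hs : IsCyc G.cw (ν.sourceDarts ++ [x]))
    (ht : IsCyc G.cw ((ν.sinkDarts G).reverse ++ [y])) (hs1 : ν.sourceDarts.length ≠ 1)
    (ht1 : (ν.sinkDarts G).length ≠ 1) (σ : ℚ) :
    H.HasSpirality ν σ ↔ σ = ((ν.rightTurn H.angle H.netBend + 2 - H.angle y : ℤ) : ℚ) := by
  have hsl : ν.sourceDarts.head?.map G.cw.symm = some x := by
    obtain ⟨d, hd⟩ := Option.ne_none_iff_exists'.1 (mt List.head?_eq_none_iff.1 ν.sourceDarts_ne_nil)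
    rw [hd, Option.map_some, ← hs.append_comm.apply_getLast (A := [x]) (y := x) rfl hd,
      Equiv.symm_apply_apply]
  have hsr : ν.sourceDarts.getLast?.map G.cw = some x := by
    obtain ⟨d, hd⟩ :=
      Option.ne_none_iff_exists'.1 (mt List.getLast?_eq_none_iff.1 ν.sourceDarts_ne_nil)
    rw [hd, Option.map_some, hs.apply_getLast (B := [x]) hd rfl]
  have htl : (ν.sinkDarts G).head?.map G.cw = some y := by
    obtain ⟨d, hd⟩ :=
      Option.ne_none_iff_exists'.1 (mt List.head?_eq_none_iff.1 (ν.sinkDarts_ne_nil (G := G)))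
    rw [hd, Option.map_some,
      ht.apply_getLast (B := [y]) (by rw [List.getLast?_reverse, hd]) rfl]
  have htr : (ν.sinkDarts G).getLast?.map G.cw.symm = some y := by
    obtain ⟨d, hd⟩ :=
      Option.ne_none_iff_exists'.1 (mt List.getLast?_eq_none_iff.1 (ν.sinkDarts_ne_nil (G := G)))
    rw [hd, Option.map_some, ← ht.append_comm.apply_getLast (A := [y]) (y := y) (z := d) rfl
      (by rw [List.head?_reverse, hd]), Equiv.symm_apply_apply]
  have key : ∀ P, ν.IsPath P →
      ((H.leftSpineTurn ν P : ℚ) + (H.rightSpineTurn ν P : ℚ)) / 2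
        = ((ν.rightTurn H.angle H.netBend + 2 - H.angle y : ℤ) : ℚ) := by
    intro P hP
    obtain ⟨d, e, A, B, A', B', hd, he, hsrc, hsnk, hturn⟩ := hP.pathTurn_eq h H
    have a1 : H.cwAngle d x = ((d :: B).map H.ang).sum :=
      cwAngle_eq_sum H (A := A) (B := []) (by simpa [hsrc] using hs) (by simp)
    have a2 : H.cwAngle y (G.rev e) = ((y :: B'.reverse).map H.ang).sum :=
      cwAngle_eq_sum H (A := []) (B := A'.reverse)
        (by simpa [hsnk] using ht.append_comm) (by simp)
    have b1 : (H.cwAngle d x : ℤ) = ((d :: B).map H.angle).sum := by rw [a1, H.cast_sum_ang]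
    have b2 : (H.cwAngle y (G.rev e) : ℤ) = H.angle y + (B'.map H.angle).sum := by
      rw [a2, H.cast_sum_ang, List.map_cons, List.sum_cons, List.map_reverse, List.sum_reverse]
    have hl : H.leftSpineTurn ν P = ν.rightTurn H.angle H.netBend + 2 - H.angle y := by
      simp only [OrthRep.leftSpineTurn, OrthRep.sourceTurn, OrthRep.sinkTurn, hs1, ht1, if_false,
        hsl, htl, hd, he, OrthRep.vertexTurn, G.rev_rev, b1, b2, hturn]
      ring
    have hr : H.rightSpineTurn ν P = ν.rightTurn H.angle H.netBend + 2 - H.angle y := by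
      simp only [OrthRep.rightSpineTurn, OrthRep.sourceTurn, OrthRep.sinkTurn, hs1, ht1, if_false,
        hsr, htr, hd, he, OrthRep.vertexTurn, G.rev_rev, b1, b2, hturn]
      ring
    rw [hl, hr]
    ring
  constructor
  · intro hσ
    obtain ⟨P, hP⟩ := ν.exists_isPath
    rw [hσ P hP, key P hP]
  · rintro rfl P hP
    exact (key P hP).symm

/-- The node has the spirality of its centre child: its right boundary is that of `r`, whose turn is
smaller by 2, and the sink turn adds 1. -/
theorem SPTree.Triple.hasSpirality {l c r : SPTree D} {dl dc dr du el ec er eu : D}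
    (h : Triple G l c r dl dc dr du el ec er eu) (hν : (SPTree.par3 l c r).Placed G)
    (H : OrthRep G) (σ : ℚ) :
    H.HasSpirality (.par3 l c r) σ ↔ σ = ((c.rightTurn H.angle H.netBend - 1 : ℤ) : ℚ) := by
  rw [H.hasSpirality_of_single_outside hν (x := du) (y := eu)
    (by simpa [sourceDarts, h.left.source, h.center.source, h.right.source] using h.source)
    (by simpa [sinkDarts, h.left.sink, h.center.sink, h.right.sink] using h.sink)
    (by simp [sourceDarts, h.left.source, h.center.source, h.right.source])
    (by simp [sinkDarts, h.left.sink, h.center.sink, h.right.sink])]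
  have h1 : (par3 l c r).rightTurn H.angle H.netBend = r.rightTurn H.angle H.netBend := rfl
  rw [h1, h.turn_right H.isRep, (H.isRep.eq_one h.sink).2.2.2]

/-! ### Counting bends -/

theorem OrthRep.bendCost_le (H : OrthRep G) {ν : SPTree D} (hn : ν.edges.Nodup) :
    ν.bendCost H.netBend ≤ H.numBends ν := by
  rw [OrthRep.numBends, ← List.sum_toFinset _ hn, SPTree.bendCost]
  push_cast
  exact Finset.sum_le_sum fun x _ => H.abs_netBend_le x

theorem IsRep.exists_orthRep_numBends {a v : D → ℤ} (h : IsRep G a v) :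
    ∃ H : OrthRep G, H.angle = a ∧ H.netBend = v ∧
      ∀ ν : SPTree D, ν.edges.Nodup → (H.numBends ν : ℤ) = ν.bendCost v := by
  obtain ⟨H, ha, hv, hl⟩ := h.exists_orthRep
  refine ⟨H, ha, hv, fun ν hn => ?_⟩
  rw [OrthRep.numBends, ← List.sum_toFinset _ hn, SPTree.bendCost]
  push_cast
  exact Finset.sum_congr rfl fun x _ => hl x

/-- The distance from `s` to the interval `[m, M]`. -/
def intervalDist (m M s : ℤ) : ℤ := max 0 (max (m - s) (s - M))

theorem intervalDist_add (m M s k : ℤ) :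
    intervalDist (m + k) (M + k) s = intervalDist m M (s - k) := by
  simp only [intervalDist]
  omega

namespace SPTree

variable {μ : SPTree D} {d e : D} {U : List D} {m M : ℤ}

/-- Translates the endpoint into turns, which exceed spiralities by one. -/
theorem Branch.isLeast (h : μ.Branch G d e U) (hm : IsLeast (G.spiralities μ 0) (m : ℚ)) :
    (∃ a v, IsRep G a v ∧ μ.bendCost v = 0 ∧ μ.rightTurn a v = m + 1) ∧
    ∀ a v, IsRep G a v → μ.bendCost v = 0 → m + 1 ≤ μ.rightTurn a v := by
  have hn := h.pendant.placed.nodup_edges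
  obtain ⟨⟨H, hH, hσ⟩, hmin⟩ := hm
  constructor
  · refine ⟨_, _, H.isRep, ?_, ?_⟩
    · have h1 := H.bendCost_le hn
      have h2 := bendCost_nonneg H.netBend μ
      rw [hH] at h1
      exact le_antisymm (by simpa using h1) h2
    · rw [H.hasSpirality_pendant h.pendant (h.angle_eq _ _ H.isRep).1, Int.cast_inj] at hσ
      linarith
  · intro a v hav hc
    obtain ⟨H, rfl, rfl, hb⟩ := hav.exists_orthRep_numBends
    have := hmin ⟨H, by have := hb μ hn; rw [hc] at this; exact_mod_cast this,
      (H.hasSpirality_pendant h.pendant (h.angle_eq _ _ H.isRep).1 _).2 rfl⟩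
    have := Int.cast_le.1 this
    linarith

theorem Branch.isGreatest (h : μ.Branch G d e U)
    (hM : IsGreatest (G.spiralities μ 0) (M : ℚ)) :
    (∃ a v, IsRep G a v ∧ μ.bendCost v = 0 ∧ μ.rightTurn a v = M + 1) ∧
    ∀ a v, IsRep G a v → μ.bendCost v = 0 → μ.rightTurn a v ≤ M + 1 := by
  have hn := h.pendant.placed.nodup_edges
  obtain ⟨⟨H, hH, hσ⟩, hmax⟩ := hM
  constructor
  · refine ⟨_, _, H.isRep, ?_, ?_⟩
    · have h1 := H.bendCost_le hn
      have h2 := bendCost_nonneg H.netBend μ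
      rw [hH] at h1
      exact le_antisymm (by simpa using h1) h2
    · rw [H.hasSpirality_pendant h.pendant (h.angle_eq _ _ H.isRep).1, Int.cast_inj] at hσ
      linarith
  · intro a v hav hc
    obtain ⟨H, rfl, rfl, hb⟩ := hav.exists_orthRep_numBends
    have := hmax ⟨H, by have := hb μ hn; rw [hc] at this; exact_mod_cast this,
      (H.hasSpirality_pendant h.pendant (h.angle_eq _ _ H.isRep).1 _).2 rfl⟩
    have := Int.cast_le.1 this
    linarith

/-- A branch with spirality `s` has at least as many bends as the distance from `s` to the
representability interval. -/
theorem Branch.intervalDist_le (h : μ.Branch G d e U)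
    (hI : G.HasRepresentabilityEndpoints μ m M) {a v : D → ℤ} (hav : IsRep G a v) :
    intervalDist m M (μ.rightTurn a v - 1) ≤ μ.bendCost v := by
  obtain ⟨hm, hm'⟩ := h.isLeast hI.1
  obtain ⟨hM, hM'⟩ := h.isGreatest hI.2
  -- The induction bound is chosen large enough for its hypothesis to hold for the given turn.
  have h1 := h.sub_bendCost_le hm hm' (m + 1 - μ.rightTurn a v).toNat a v hav (by omega)
  have h2 := h.le_add_bendCost hM hM' (μ.rightTurn a v - (M + 1)).toNat a v hav (by omega)
  have h3 := bendCost_nonneg v μ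
  simp only [intervalDist]
  omega

/-- Every spirality is attained by a branch, with as many bends as its distance to the
representability interval. -/
theorem Branch.exists_intervalDist (h : μ.Branch G d e U)
    (hI : G.HasRepresentabilityEndpoints μ m M) (s : ℤ) :
    ∃ a v, IsRep G a v ∧ μ.rightTurn a v = s + 1 ∧ μ.bendCost v ≤ intervalDist m M s := by
  obtain ⟨hm, -⟩ := h.isLeast hI.1
  obtain ⟨hM, -⟩ := h.isGreatest hI.2
  -- The point `s₀` will be the one of the interval nearest to `s`; the remaining `|s - s₀|` turns
  -- are bends on `d`.
  have key : ∀ s₀ : ℤ, (∃ a v, IsRep G a v ∧ μ.bendCost v = 0 ∧ μ.rightTurn a v = s₀ + 1) →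
      |s - s₀| ≤ intervalDist m M s →
      ∃ a v, IsRep G a v ∧ μ.rightTurn a v = s + 1 ∧ μ.bendCost v ≤ intervalDist m M s := by
    rintro s₀ ⟨a, v, hav, hc, ht⟩ hd
    refine ⟨a, _, hav.add_star h.isCyc (s - s₀), ?_, ?_⟩
    · rw [h.pendant.rightTurn_add_star h.mem h.eq_of_mem, ht]; ring
    · have := h.pendant.bendCost_add_star_le h.mem h.eq_of_mem v (s - s₀)
      linarith
  simp only [intervalDist, abs_eq_max_neg] at key ⊢
  rcases lt_or_ge s m with h1 | h1
  · exact key m hm (by omega)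
  rcases lt_or_ge M s with h2 | h2
  · exact key M hM (by omega)
  · refine key s ?_ (by omega)
    obtain ⟨a, v, hav, hc, ht⟩ := h.exists_of_mem_interval hm hM (s - m).toNat (by omega)
    exact ⟨a, v, hav, hc, by omega⟩

end SPTree

theorem PlaneGraph.HasRepresentabilityEndpoints.le {μ : SPTree D} {m M : ℤ}
    (h : G.HasRepresentabilityEndpoints μ m M) : m ≤ M :=
  Int.cast_le.1 (h.1.2 h.2.1)

end Par3

end OrthoSP

/-! ### Minimising the sum of the distances to the three shifted intervals. -/

open OrthoSP in
theorem mainTheorem5 {D : Type*} [Fintype D] [DecidableEq D]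
    (G : OrthoSP.PlaneGraph D) (hdeg : G.IsFourGraph)
    (T : OrthoSP.SPTree D) (hT : G.HasSPTree T)
    (μl μc μr ν : OrthoSP.SPTree D) (hν : ν = OrthoSP.SPTree.par3 μl μc μr) (hνT : ν.IsNode T)
    (hl : G.RectilinearPlanar μl) (hc : G.RectilinearPlanar μc) (hr : G.RectilinearPlanar μr)
    (ml Ml mc Mc mr Mr : ℤ)
    (hIl : G.HasRepresentabilityEndpoints μl ml Ml)
    (hIc : G.HasRepresentabilityEndpoints μc mc Mc)
    (hIr : G.HasRepresentabilityEndpoints μr mr Mr)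
    (hnot : ¬ G.RectilinearPlanar ν)
    (mbar Mbar : Fin 3 → ℤ) (hmbar : mbar = ![ml - 2, mc, mr + 2])
    (hMbar : Mbar = ![Ml - 2, Mc, Mr + 2])
    (x y z : Fin 3) (hz : ∀ t, mbar t ≤ mbar z) (hx : ∀ t, Mbar x ≤ Mbar t)
    (hyx : y ≠ x) (hyz : y ≠ z) :
    x ≠ z ∧
    ∃ b : ℕ, G.IsBudget ν b ∧ (b : ℤ) = mbar z - Mbar x ∧
      G.spiralities ν b =
        (fun k : ℤ => (k : ℚ)) ''
          Set.Icc (max (Mbar x) (mbar y)) (min (mbar z) (Mbar y)) := by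
  have hP : ν.Placed G := hνT.placed (SPTree.placed_of_hasSPTree hT)
  have hn : ν.edges.Nodup := hP.nodup_edges
  subst hν
  obtain ⟨dl, dc, dr, du, el, ec, er, eu, h⟩ := hP.exists_triple hdeg
  have hdist : ∀ s, ∑ t, intervalDist (mbar t) (Mbar t) s
      = intervalDist ml Ml (s - -2) + intervalDist mc Mc s + intervalDist mr Mr (s - 2) := by
    intro s
    rw [Fin.sum_univ_three, hmbar, hMbar, ← intervalDist_add, ← intervalDist_add]
    rfl
  -- Each child costs at least its distance, and the common faces tie the three spiralities to that
  -- of the centre.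
  have hlow : ∀ H : OrthRep G, ∑ t, intervalDist (mbar t) (Mbar t)
      (μc.rightTurn H.angle H.netBend - 1) ≤ H.numBends (.par3 μl μc μr) := by
    intro H
    refine le_trans ?_ (H.bendCost_le hn)
    have h1 := h.branch_left.intervalDist_le hIl H.isRep
    have h2 := h.branch_center.intervalDist_le hIc H.isRep
    have h3 := h.branch_right.intervalDist_le hIr H.isRep
    have h4 := h.turn_left H.isRep
    have h5 := h.turn_right H.isRep
    rw [show μl.rightTurn H.angle H.netBend - 1
      = μc.rightTurn H.angle H.netBend - 1 - -2 by linarith] at h1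
    rw [show μr.rightTurn H.angle H.netBend - 1
      = μc.rightTurn H.angle H.netBend - 1 - 2 by linarith] at h3
    rw [h.bendCost, hdist]
    linarith
  -- Optimal representations of the children at `s + 2`, `s`, `s - 2` are glued; equality of the
  -- cost follows from `hlow`.
  have hup : ∀ s : ℤ, ∃ H : OrthRep G, H.HasSpirality (.par3 μl μc μr) (s : ℚ) ∧
      (H.numBends (.par3 μl μc μr) : ℤ) = ∑ t, intervalDist (mbar t) (Mbar t) s := by
    intro s
    obtain ⟨al, vl, hl1, hl2, hl3⟩ := h.branch_left.exists_intervalDist hIl (s + 2)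
    obtain ⟨ac, vc, hc1, hc2, hc3⟩ := h.branch_center.exists_intervalDist hIc s
    obtain ⟨ar, vr, hr1, hr2, hr3⟩ := h.branch_right.exists_intervalDist hIr (s - 2)
    obtain ⟨a, v, hav, ht, hcost⟩ := h.combine hl1 hc1 hr1 (by linarith) (by linarith)
    obtain ⟨H, rfl, rfl, hb⟩ := hav.exists_orthRep_numBends
    have hs : μc.rightTurn H.angle H.netBend - 1 = s := by linarith
    refine ⟨H, (h.hasSpirality hP H _).2 (by rw [hs]), le_antisymm ?_ (hs ▸ hlow H)⟩
    rw [hb _ hn, hcost, hdist, sub_neg_eq_add]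
    linarith
  have hle : ∀ t, mbar t ≤ Mbar t := by
    have := hIl.le
    have := hIc.le
    have := hIr.le
    intro t
    fin_cases t <;> simp [hmbar, hMbar] <;> omega
  -- Otherwise `mbar z` lies in all three intervals, and spirality `mbar z` needs no bend.
  have hlt : Mbar x < mbar z := by
    by_contra hge
    push Not at hge
    obtain ⟨H, -, hH⟩ := hup (mbar z)
    refine hnot ⟨H, ?_⟩
    rw [Finset.sum_eq_zero] at hH
    · exact_mod_cast hH
    · intro t _
      have := hz t
      have := hx t
      simp only [intervalDist]
      omega
  have hxz : x ≠ z := by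
    rintro rfl
    have := hle x
    omega
  have huniv : (Finset.univ : Finset (Fin 3)) = {x, y, z} := by
    clear hz hx hlt
    revert x y z
    decide
  have hsum : ∀ s, ∑ t, intervalDist (mbar t) (Mbar t) s = intervalDist (mbar x) (Mbar x) s
      + (intervalDist (mbar y) (Mbar y) s + intervalDist (mbar z) (Mbar z) s) := by
    intro s
    rw [huniv, Finset.sum_insert (by simp [hyx.symm, hxz]), Finset.sum_pair hyz]
  have hxx := hle x
  have hyy := hle y
  have hzz := hle z
  have hzx := hz x
  have hzy := hz y
  have hxy := hx y
  have hxz' := hx z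
  refine ⟨hxz, (mbar z - Mbar x).toNat, ⟨?_, ?_⟩, by omega, ?_⟩
  -- This point lies between `Mbar x` and `mbar z` and in the interval of `y`, so it attains the
  -- minimum.
  · obtain ⟨H, -, hH⟩ := hup (max (Mbar x) (mbar y))
    refine ⟨H, ?_⟩
    rw [hsum] at hH
    simp only [intervalDist] at hH
    omega
  · rintro n ⟨H, rfl⟩
    have := hlow H
    rw [hsum] at this
    simp only [intervalDist] at this
    omega
  · ext σ
    constructor
    · rintro ⟨H, hH, hσ⟩
      rw [h.hasSpirality hP] at hσ
      refine ⟨_, ?_, hσ.symm⟩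
      -- The distances to `x` and `z` already sum to at least the budget. Equality forces the
      -- spirality between `Mbar x` and `mbar z` and into the interval of `y`.
      have := hlow H
      rw [hsum, hH] at this
      simp only [intervalDist] at this
      rw [Set.mem_Icc]
      omega
    · rintro ⟨s, hs, rfl⟩
      obtain ⟨H, hσ, hH⟩ := hup s
      refine ⟨H, ?_, hσ⟩
      rw [hsum] at hH
      rw [Set.mem_Icc] at hs
      simp only [intervalDist] at hH
      omega
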